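/- Let $1\le k\le n-1$, let $\Delta_{k,n}=\{x\in[0,1]^n:\sum_i x_i=k\}$ with relative interior $\Delta_{k,n}^\circ$, and write $x_A=\sum_{a\in A}x_a$, $e_J=\sum_{j\in J}e_j$. A decorated ordered set partition $\mathbf S=((S_1)_{s_1},\dots,(S_\ell)_{s_\ell})$ of $(\{1,\dots,n\},k)$ is an ordered partition of $\{1,\dots,n\}$ into nonempty blocks $S_1,\dots,S_\ell$ together with integers $s_j$ with $\sum_j s_j=k$; it is of type $\Delta_{k,n}$ if $1\le s_j\le |S_j|-1$ for all $j$. For each $i$ let (indices modulo $\ell$) $$[(S_i)_{s_i},\dots,(S_{i-1})_{s_{i-1}}]=\Big\{x:\ \textstyle\sum_a x_a=k,\ x_{S_i\cup\cdots\cup S_{i+m-1}}\ge s_i+\cdots+s_{i+m-1}\ (1\le m\le \ell-1)\Big\}.$$ The blade $((\mathbf S))$ is the union over $i$ of the boundaries of these $\ell$ cones (the boundary of a cone being the union of its facets). For a cyclic order $\sigma=(\sigma_1,\dots,\sigma_n)$ of $\{1,\dots,n\}$, $((\sigma))_{e_J}$ denotes the translate by $e_J$ of the blade of $((\{\sigma_1\})_0,\dots,(\{\sigma_n\})_0)$.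 Let $\mathbf S,\mathbf T$ be decorated ordered set partitions of type $\Delta_{k,n}$, and let $\Pi_1,\Pi_2$ be the multi-splits of $\Delta_{k,n}$ whose maximal cells are the polytopes $[(S_i)_{s_i},\dots,(S_{i-1})_{s_{i-1}}]\cap\Delta_{k,n}$ and $[(T_j)_{t_j},\dots,(T_{j-1})_{t_{j-1}}]\cap\Delta_{k,n}$, respectively. Suppose that for one cyclic order $\sigma$ and $k$-element subsets $J_1,J_2$ of $\{1,\dots,n\}$ the blades $((\sigma))_{e_{J_1}}$ and $((\sigma))_{e_{J_2}}$ induce $\Pi_1$ and $\Pi_2$, that is, $$((\mathbf S))\cap\Delta_{k,n}^\circ=((\sigma))_{e_{J_1}}\cap\Delta_{k,n}^\circ,\qquad ((\mathbf T))\cap\Delta_{k,n}^\circ=((\sigma))_{e_{J_2}}\cap\Delta_{k,n}^\circ .$$ Then the common refinement of $\Pi_1$ and $\Pi_2$, whose maximal cells are the $(n-1)$-dimensional intersections of a maximal cell of $\Pi_1$ with a maximal cell of $\Pi_2$, is a matroid subdivision of $\Delta_{k,n}$ (a polytopal subdivision all of whose maximal cells are matroid polytopes, i.e. convex hulls of $\{e_B: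 B \text{ a basis of } M\}$ for a matroid $M$ on $\{1,\dots,n\}$) if and only if $J_1,J_2$ are weakly separated with respect to $\sigma$: there are no $i_1,i_2\in J_1\setminus J_2$ and $j_1,j_2\in J_2\setminus J_1$ that occur in the order $i_1,j_1,i_2,j_2$, up to cyclic rotation, in $\sigma$. -/

import Mathlib

/-- The vertex `e_J = ∑_{j ∈ J} e_j` of `ℝⁿ`. -/
def eVec {n : ℕ} (J : Finset (Fin n)) : Fin n → ℝ := fun i => if i ∈ J then 1 else 0

/-- The hypersimplex `Δ_{k,n}`. -/
def hypersimplex (k n : ℕ) : Set (Fin n → ℝ) :=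
  {x | (∀ i, 0 ≤ x i ∧ x i ≤ 1) ∧ ∑ i, x i = (k : ℝ)}

/-- The relative interior of the hypersimplex `Δ_{k,n}` (for `1 ≤ k ≤ n - 1`). -/
def openHypersimplex (k n : ℕ) : Set (Fin n → ℝ) :=
  {x | (∀ i, 0 < x i ∧ x i < 1) ∧ ∑ i, x i = (k : ℝ)}

/-- A decorated ordered set partition `((S₁)_{s₁}, …, (S_ℓ)_{s_ℓ})` of `({1, …, n}, k)`. -/
structure DecoratedOSP (n k ℓ : ℕ) where
  block : Fin ℓ → Finset (Fin n)
  weight : Fin ℓ → ℤ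
  block_nonempty : ∀ j, (block j).Nonempty
  block_disjoint : ∀ i j, i ≠ j → Disjoint (block i) (block j)
  block_cover : ∀ a, ∃ j, a ∈ block j
  weight_sum : ∑ j, weight j = (k : ℤ)

namespace DecoratedOSP

/-- `cyc i t` is the index `i + t`, read cyclically modulo `ℓ`. -/
def cyc {ℓ : ℕ} (i : Fin ℓ) (t : ℕ) : Fin ℓ :=
  ⟨((i : ℕ) + t) % ℓ, Nat.mod_lt _ i.pos⟩

variable {n k ℓ : ℕ}

/-- Type `Δ_{k,n}`: `1 ≤ s_j ≤ |S_j| - 1` for all `j`. -/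
def IsHypersimplicial (S : DecoratedOSP n k ℓ) : Prop :=
  ∀ j, 1 ≤ S.weight j ∧ S.weight j ≤ ((S.block j).card : ℤ) - 1

/-- `x_{S_i ∪ ⋯ ∪ S_{i+m-1}}` (cyclic indices, used for `m < ℓ`). -/
def partialCoord (S : DecoratedOSP n k ℓ) (i : Fin ℓ) (m : ℕ) (x : Fin n → ℝ) : ℝ :=
  ∑ t ∈ Finset.range m, ∑ a ∈ S.block (cyc i t), x a

/-- `s_i + ⋯ + s_{i+m-1}` (cyclic indices, used for `m < ℓ`). -/
def partialWeight (S : DecoratedOSP n k ℓ) (i : Fin ℓ) (m : ℕ) : ℝ :=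
  ∑ t ∈ Finset.range m, (S.weight (cyc i t) : ℝ)

/-- The cone `[(S_i)_{s_i}, (S_{i+1})_{s_{i+1}}, …, (S_{i-1})_{s_{i-1}}]` in the affine
hyperplane `∑ x_a = k`: the cyclic block rotation that starts with the block `S_i`. -/
def plate (S : DecoratedOSP n k ℓ) (i : Fin ℓ) : Set (Fin n → ℝ) :=
  {x | ∑ a, x a = (k : ℝ) ∧
    ∀ m, 1 ≤ m → m < ℓ → S.partialWeight i m ≤ S.partialCoord i m x}

/-- The boundary of the cone `plate S i`, i.e. the union of its facets (its faces of
codimension one): one of the `ℓ - 1` facet inequalities is an equality. -/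
def plateBoundary (S : DecoratedOSP n k ℓ) (i : Fin ℓ) : Set (Fin n → ℝ) :=
  {x | x ∈ S.plate i ∧ ∃ m, 1 ≤ m ∧ m < ℓ ∧ S.partialCoord i m x = S.partialWeight i m}

/-- The blade `(((S₁)_{s₁}, …, (S_ℓ)_{s_ℓ}))`. -/
def blade (S : DecoratedOSP n k ℓ) : Set (Fin n → ℝ) := ⋃ i, S.plateBoundary i

/-- The maximal cells of the multi-split given by `S`: the polytopes
`[(S_i)_{s_i}, …, (S_{i-1})_{s_{i-1}}] ∩ Δ_{k,n}`, one for every cyclic block rotation. -/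
def cells (S : DecoratedOSP n k ℓ) : Set (Set (Fin n → ℝ)) :=
  Set.range fun i => S.plate i ∩ hypersimplex k n

/-- The decorated ordered set partition `(σ₁, …, σ_n)` into singletons, all weights `0`. -/
def singletons {n : ℕ} (σ : Equiv.Perm (Fin n)) : DecoratedOSP n 0 n where
  block j := {σ j}
  weight _ := 0
  block_nonempty j := Finset.singleton_nonempty _
  block_disjoint i j h := by simpa using h
  block_cover a := ⟨σ.symm a, by simp⟩
  weight_sum := by simp

end DecoratedOSP

/-- The blade `((σ₁, …, σ_n))_{e_J}`: the translate by `e_J` of the blade `((σ₁, …, σ_n))`. -/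
def bladeAt {n : ℕ} (σ : Equiv.Perm (Fin n)) (J : Finset (Fin n)) : Set (Fin n → ℝ) :=
  (fun x => x + eVec J) '' (DecoratedOSP.singletons σ).blade

/-- `P ⊆ ℝⁿ` has dimension `n - 1`. -/
def IsFullDim {n : ℕ} (P : Set (Fin n → ℝ)) : Prop :=
  Module.finrank ℝ (vectorSpan ℝ P) + 1 = n

/-- The maximal cells of the common refinement of two subdivisions (given by their maximal
cells): the `(n-1)`-dimensional intersections of a maximal cell of the first with a maximal
cell of the second. -/
def commonRefinement {n : ℕ} (C D : Set (Set (Fin n → ℝ))) : Set (Set (Fin n → ℝ)) :=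
  {R | (∃ P ∈ C, ∃ Q ∈ D, R = P ∩ Q) ∧ IsFullDim R}

/-- `C` is the set of maximal cells of a polytopal subdivision of `Δ_{k,n}`: finitely many
`(n-1)`-dimensional polytopes that cover `Δ_{k,n}`, any two of which meet in a common
(possibly empty) face. -/
structure IsPolytopalSubdivision (k n : ℕ) (C : Set (Set (Fin n → ℝ))) : Prop where
  finite : C.Finite
  polytope : ∀ P ∈ C, ∃ V : Set (Fin n → ℝ), V.Finite ∧ P = convexHull ℝ V
  fullDim : ∀ P ∈ C, IsFullDim P
  cover : ⋃₀ C = hypersimplex k n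
  face : ∀ P ∈ C, ∀ Q ∈ C, IsExposed ℝ P (P ∩ Q)

/-- `P` is a matroid polytope: the convex hull of the vectors `e_B`, where `B` runs over the
bases of a matroid on `{1, …, n}`. -/
def IsMatroidPolytope {n : ℕ} (P : Set (Fin n → ℝ)) : Prop :=
  ∃ M : Matroid (Fin n), M.E = Set.univ ∧
    P = convexHull ℝ {x | ∃ B : Finset (Fin n), M.IsBase (B : Set (Fin n)) ∧ x = eVec B}

/-- A matroid subdivision of `Δ_{k,n}`: every maximal cell is a matroid polytope. -/
def IsMatroidSubdivision (k n : ℕ) (C : Set (Set (Fin n → ℝ))) : Prop :=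
  IsPolytopalSubdivision k n C ∧ ∀ P ∈ C, IsMatroidPolytope P

/-- `a, b, c, d` occur in this order, up to cyclic rotation, in the list `(σ₁, …, σ_n)`
(`σ.symm a` is the position of `a`). -/
def CyclicallyOrdered {n : ℕ} (σ : Equiv.Perm (Fin n)) (a b c d : Fin n) : Prop :=
  (σ.symm a < σ.symm b ∧ σ.symm b < σ.symm c ∧ σ.symm c < σ.symm d) ∨
  (σ.symm b < σ.symm c ∧ σ.symm c < σ.symm d ∧ σ.symm d < σ.symm a) ∨
  (σ.symm c < σ.symm d ∧ σ.symm d < σ.symm a ∧ σ.symm a < σ.symm b) ∨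
  (σ.symm d < σ.symm a ∧ σ.symm a < σ.symm b ∧ σ.symm b < σ.symm c)

/-- `I` and `J` are weakly separated with respect to the cyclic order `(σ₁, …, σ_n)`. -/
def WeaklySeparated {n : ℕ} (σ : Equiv.Perm (Fin n)) (I J : Finset (Fin n)) : Prop :=
  ¬ ∃ i₁ i₂ j₁ j₂ : Fin n, i₁ ∈ I \ J ∧ i₂ ∈ I \ J ∧ j₁ ∈ J \ I ∧ j₂ ∈ J \ I ∧
    CyclicallyOrdered σ i₁ j₁ i₂ j₂

/-! On the hyperplane where the coordinates sum to `k`, the function `height` of a decorated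
partition is periodic along the cyclic block order, and a point lies in the cone starting at block
`cyc i d` exactly when `d` minimises its height (`mem_plate_cyc_iff`). Off the blade the minimiser
is unique modulo `ℓ`. The open regions are therefore convex and disjoint, they can be recovered from
the blade, and the full-dimensional cells are their closures. This lets both multi-splits be
replaced by the singleton partitions `ofSet σ J₁` and `ofSet σ J₂` (`commonRefinement_congr`).

For these the cells are alcoved: inside the hypersimplex they are cut out by integer bounds on sums
over cyclic intervals of `σ`. Rounding the partial sums of a point with a uniformly random offset
writes it as an average of 0/1 points of the same cell (`cell_eq_convexHull`). Hence the common
refinement is always a polytopal subdivision (`isPolytopalSubdivision`), and only basis exchange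
remains to be decided.

Encode a set `B` by its counting path `count σ p B`, and let `C₁`, `C₂` be the paths of `J₁`, `J₂`.
A cell consists of the paths `X` for which `X - C₁` and `X - C₂` are minimal at two prescribed
positions. Put `D = C₁ - C₂`.

If `J₁`, `J₂` are weakly separated, `D` has no low-high-low pattern with negative lows, and this is
what the exchange argument for paths needs (`exists_exchange_step`).

If they are not, then from a suitable starting point there is a level `s ≤ 0` such that `D` goes
below `s`, back to at least `s`, and below again. The paths `max C₁ (C₂ + s)` and `max C₁ (C₂ + s -
1)` lie in a common cell. A symmetric exchange would change them by `g` and `-g`, where `g` is plus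
or minus the indicator of an interval. Tightness forces `g` to vanish where `D ≥ s` and to be a
nonzero constant where `D < s`, which is not an interval (`weaklySeparated_of_isMatroidPolytope`).
-/

open scoped Topology
open MeasureTheory

/-! ### Plates as regions where a periodic height is minimal -/

namespace DecoratedOSP

variable {n k ℓ : ℕ}

lemma cyc_zero (i : Fin ℓ) : cyc i 0 = i := by
  ext; simp [cyc, Nat.mod_eq_of_lt i.isLt]

lemma cyc_cyc (i : Fin ℓ) (a b : ℕ) : cyc (cyc i a) b = cyc i (a + b) := by
  ext; simp [cyc, Nat.add_assoc]

lemma exists_cyc_eq (i j : Fin ℓ) : ∃ d < ℓ, cyc i d = j := by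
  refine ⟨((j : ℕ) + ℓ - i) % ℓ, Nat.mod_lt _ i.pos, ?_⟩
  ext
  have : (i : ℕ) + ((j : ℕ) + ℓ - i) = j + ℓ := by have := i.isLt; omega
  simp [cyc, this, Nat.mod_eq_of_lt j.isLt]

lemma cyc_eq_cyc_iff (i : Fin ℓ) (a b : ℕ) : cyc i a = cyc i b ↔ a % ℓ = b % ℓ := by
  rw [Fin.ext_iff]
  exact ⟨fun h => Nat.ModEq.add_left_cancel' (i : ℕ) h, fun h => Nat.ModEq.add_left (i : ℕ) h⟩

lemma cyc_injOn (i : Fin ℓ) {a b : ℕ} (ha : a < ℓ) (hb : b < ℓ) (h : cyc i a = cyc i b) :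
    a = b := by
  rwa [cyc_eq_cyc_iff, Nat.mod_eq_of_lt ha, Nat.mod_eq_of_lt hb] at h

lemma sum_range_cyc {M : Type*} [AddCommMonoid M] (i : Fin ℓ) (f : Fin ℓ → M) :
    ∑ t ∈ Finset.range ℓ, f (cyc i t) = ∑ j, f j := by
  refine Finset.sum_bij (fun t _ => cyc i t) (fun _ _ => Finset.mem_univ _) ?_ ?_ (fun _ _ => rfl)
  · intro a ha b hb h
    exact cyc_injOn i (Finset.mem_range.1 ha) (Finset.mem_range.1 hb) h
  · intro j _
    obtain ⟨d, hd, h⟩ := exists_cyc_eq i j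
    exact ⟨d, Finset.mem_range.2 hd, h⟩

lemma sum_block (S : DecoratedOSP n k ℓ) (x : Fin n → ℝ) :
    ∑ j, ∑ a ∈ S.block j, x a = ∑ a, x a := by
  rw [← Finset.sum_biUnion]
  · congr 1
    ext a
    simpa using S.block_cover a
  · intro i _ j _ h
    exact S.block_disjoint i j h

/-- The difference `x_{S_i ∪ ⋯ ∪ S_{i+m-1}} - (s_i + ⋯ + s_{i+m-1})`. -/
def height (S : DecoratedOSP n k ℓ) (i : Fin ℓ) (m : ℕ) (x : Fin n → ℝ) : ℝ :=
  S.partialCoord i m x - S.partialWeight i m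

lemma height_eq_sum (S : DecoratedOSP n k ℓ) (i : Fin ℓ) (m : ℕ) (x : Fin n → ℝ) :
    S.height i m x =
      ∑ t ∈ Finset.range m, (∑ a ∈ S.block (cyc i t), x a - S.weight (cyc i t)) := by
  simp [height, partialCoord, partialWeight, Finset.sum_sub_distrib]

@[simp] lemma height_zero (S : DecoratedOSP n k ℓ) (i : Fin ℓ) (x : Fin n → ℝ) :
    S.height i 0 x = 0 := by simp [height_eq_sum]

lemma height_add (S : DecoratedOSP n k ℓ) (i : Fin ℓ) (a b : ℕ) (x : Fin n → ℝ) :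
    S.height i (a + b) x = S.height i a x + S.height (cyc i a) b x := by
  simp only [height_eq_sum, Finset.sum_range_add, cyc_cyc]

lemma height_period (S : DecoratedOSP n k ℓ) (i : Fin ℓ) {x : Fin n → ℝ}
    (hx : ∑ a, x a = (k : ℝ)) : S.height i ℓ x = 0 := by
  rw [height_eq_sum, sum_range_cyc i fun j => ∑ a ∈ S.block j, x a - (S.weight j : ℝ),
    Finset.sum_sub_distrib, S.sum_block, hx]
  have := congrArg (Int.cast (R := ℝ)) S.weight_sum
  push_cast at this
  rw [this, sub_self]

lemma height_add_period (S : DecoratedOSP n k ℓ) (i : Fin ℓ) (m : ℕ) {x : Fin n → ℝ}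
    (hx : ∑ a, x a = (k : ℝ)) : S.height i (m + ℓ) x = S.height i m x := by
  rw [height_add, height_period _ _ hx, add_zero]

lemma height_mod (S : DecoratedOSP n k ℓ) (i : Fin ℓ) (m : ℕ) {x : Fin n → ℝ}
    (hx : ∑ a, x a = (k : ℝ)) : S.height i (m % ℓ) x = S.height i m x := by
  conv_rhs => rw [← Nat.mod_add_div m ℓ]
  induction m / ℓ with
  | zero => simp
  | succ q ih => rw [Nat.mul_succ, ← add_assoc, height_add_period _ _ _ hx, ih]

lemma mem_plate_iff (S : DecoratedOSP n k ℓ) (i : Fin ℓ) {x : Fin n → ℝ}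
    (hx : ∑ a, x a = (k : ℝ)) : x ∈ S.plate i ↔ ∀ m, 0 ≤ S.height i m x := by
  constructor
  · rintro ⟨-, h⟩ m
    rw [← height_mod _ _ _ hx]
    rcases Nat.eq_zero_or_pos (m % ℓ) with h0 | h0
    · simp [h0]
    · exact sub_nonneg.2 (h _ h0 (Nat.mod_lt _ i.pos))
  · exact fun h => ⟨hx, fun m _ _ => sub_nonneg.1 (h m)⟩

/-- Heights measured from `cyc i d` are the heights measured from `i` minus the value at `d`, so
nonnegativity of the former is minimality at `d`. With a fixed base index `i`, all plates are
compared through one function of `m`. -/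
lemma mem_plate_cyc_iff (S : DecoratedOSP n k ℓ) (i : Fin ℓ) (d : ℕ) {x : Fin n → ℝ}
    (hx : ∑ a, x a = (k : ℝ)) :
    x ∈ S.plate (cyc i d) ↔ ∀ m, S.height i d x ≤ S.height i m x := by
  rw [mem_plate_iff _ _ hx]
  constructor
  · intro h m
    -- A natural number congruent to `m - d` modulo `ℓ`.
    have h1 := h (m + ℓ * d - d)
    have : d + (m + ℓ * d - d) = m + ℓ * d := by
      have : 1 * d ≤ ℓ * d := Nat.mul_le_mul_right d i.pos
      omega
    have h2 := S.height_add i d (m + ℓ * d - d) x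
    rw [this, ← height_mod _ _ _ hx, Nat.add_mul_mod_self_left, height_mod _ _ _ hx] at h2
    linarith
  · intro h m
    have := h (d + m)
    rw [height_add] at this
    linarith

lemma mem_plate_cyc_iff_lt (S : DecoratedOSP n k ℓ) (i : Fin ℓ) (d : ℕ) {x : Fin n → ℝ}
    (hx : ∑ a, x a = (k : ℝ)) :
    x ∈ S.plate (cyc i d) ↔ ∀ m < ℓ, S.height i d x ≤ S.height i m x := by
  rw [mem_plate_cyc_iff _ _ _ hx]
  refine ⟨fun h m _ => h m, fun h m => ?_⟩
  rw [← height_mod _ _ m hx]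
  exact h _ (Nat.mod_lt _ i.pos)

/-- The linear form `x ↦ x_{S_i ∪ ⋯ ∪ S_{i+m-1}}`. -/
def coordForm (S : DecoratedOSP n k ℓ) (i : Fin ℓ) (m : ℕ) : (Fin n → ℝ) →ₗ[ℝ] ℝ :=
  ∑ t ∈ Finset.range m, ∑ a ∈ S.block (cyc i t), LinearMap.proj a

lemma height_eq_coordForm (S : DecoratedOSP n k ℓ) (i : Fin ℓ) (m : ℕ) (x : Fin n → ℝ) :
    S.height i m x = S.coordForm i m x - S.partialWeight i m := by
  simp [height, coordForm, partialCoord, LinearMap.sum_apply]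

lemma continuous_height (S : DecoratedOSP n k ℓ) (i : Fin ℓ) (m : ℕ) :
    Continuous (S.height i m) := by
  unfold height partialCoord
  fun_prop

lemma height_combo (S : DecoratedOSP n k ℓ) (i : Fin ℓ) (m : ℕ) (x y : Fin n → ℝ) {a b : ℝ}
    (hab : a + b = 1) :
    S.height i m (a • x + b • y) = a * S.height i m x + b * S.height i m y := by
  simp only [height_eq_coordForm, map_add, map_smul, smul_eq_mul]
  linear_combination (S.partialWeight i m) * hab

/-- The set where all facet inequalities of `plate S i` are strict. -/
def strictPlate (S : DecoratedOSP n k ℓ) (i : Fin ℓ) : Set (Fin n → ℝ) :=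
  {x | ∀ m, 1 ≤ m → m < ℓ → 0 < S.height i m x}

lemma isOpen_strictPlate (S : DecoratedOSP n k ℓ) (i : Fin ℓ) : IsOpen (S.strictPlate i) := by
  have : S.strictPlate i = ⋂ m : Fin ℓ, {x | 1 ≤ (m : ℕ) → 0 < S.height i m x} := by
    ext x
    simp only [strictPlate, Set.mem_ofPred_eq, Set.mem_iInter]
    exact ⟨fun h m hm => h m hm m.2, fun h m h1 h2 => h ⟨m, h2⟩ h1⟩
  rw [this]
  refine isOpen_iInter_of_finite fun m => ?_
  by_cases hm : 1 ≤ (m : ℕ)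
  · simpa [hm] using isOpen_lt continuous_const (S.continuous_height i m)
  · simp [hm]

lemma convex_strictPlate (S : DecoratedOSP n k ℓ) (i : Fin ℓ) : Convex ℝ (S.strictPlate i) := by
  intro x hx y hy a b ha hb hab m h1 h2
  rw [height_combo _ _ _ _ _ hab]
  have := hx m h1 h2
  have := hy m h1 h2
  rcases ha.eq_or_lt with rfl | ha
  · have : b = 1 := by linarith
    simpa [this]
  · positivity

lemma convex_plate (S : DecoratedOSP n k ℓ) (i : Fin ℓ) : Convex ℝ (S.plate i) := by
  rintro x hx y hy a b ha hb hab
  have hsum : ∑ c, (a • x + b • y) c = (k : ℝ) := by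
    simp only [Pi.add_apply, Pi.smul_apply, smul_eq_mul, Finset.sum_add_distrib,
      ← Finset.mul_sum, hx.1, hy.1]
    linear_combination (k : ℝ) * hab
  rw [mem_plate_iff _ _ hsum]
  intro m
  rw [height_combo _ _ _ _ _ hab]
  have h1 := (S.mem_plate_iff i hx.1).1 hx m
  have h2 := (S.mem_plate_iff i hy.1).1 hy m
  positivity

lemma isClosed_plate (S : DecoratedOSP n k ℓ) (i : Fin ℓ) : IsClosed (S.plate i) := by
  have : S.plate i = {x | ∑ a, x a = (k : ℝ)} ∩ ⋂ m : ℕ, {x | 0 ≤ S.height i m x} := by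
    ext x
    simp only [Set.mem_inter_iff, Set.mem_ofPred_eq, Set.mem_iInter]
    exact ⟨fun h => ⟨h.1, (S.mem_plate_iff i h.1).1 h⟩, fun h => (S.mem_plate_iff i h.1).2 h.2⟩
  rw [this]
  exact (isClosed_eq (by fun_prop) continuous_const).inter
    (isClosed_iInter fun m => isClosed_le continuous_const (S.continuous_height i m))

lemma strictPlate_subset_plate (S : DecoratedOSP n k ℓ) (i : Fin ℓ) {x : Fin n → ℝ}
    (hx : ∑ a, x a = (k : ℝ)) (h : x ∈ S.strictPlate i) : x ∈ S.plate i :=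
  ⟨hx, fun m h1 h2 => (sub_pos.1 (h m h1 h2)).le⟩

lemma eq_of_mem_strictPlate_of_mem_plate (S : DecoratedOSP n k ℓ) {i j : Fin ℓ}
    {x : Fin n → ℝ} (hi : x ∈ S.strictPlate i) (hj : x ∈ S.plate j) : i = j := by
  obtain ⟨d, hd, rfl⟩ := exists_cyc_eq i j
  have h := (S.mem_plate_cyc_iff i d hj.1).1 hj 0
  rw [height_zero] at h
  rcases Nat.eq_zero_or_pos d with rfl | h0
  · rw [cyc_zero]
  · exact absurd (hi d h0 hd) h.not_gt

lemma exists_mem_plate (S : DecoratedOSP n k ℓ) (hn : 0 < n) {x : Fin n → ℝ}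
    (hx : ∑ a, x a = (k : ℝ)) : ∃ i, x ∈ S.plate i := by
  obtain ⟨i, -⟩ := S.block_cover ⟨0, hn⟩
  obtain ⟨d, -, hd⟩ := Finset.exists_min_image (Finset.range ℓ) (fun d => S.height i d x)
    ⟨0, Finset.mem_range.2 i.pos⟩
  exact ⟨cyc i d, (S.mem_plate_cyc_iff_lt i d hx).2 fun m hm => hd m (Finset.mem_range.2 hm)⟩

/-- Some plate always contains `x`, because a minimiser of the height exists. A boundary point has
two minimisers, while a point of a strict plate has only one and so lies in no other plate. -/
lemma notMem_blade_iff (S : DecoratedOSP n k ℓ) (hn : 0 < n) {x : Fin n → ℝ}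
    (hx : ∑ a, x a = (k : ℝ)) : x ∉ S.blade ↔ ∃ i, x ∈ S.strictPlate i := by
  constructor
  · intro h
    obtain ⟨i, hi⟩ := S.exists_mem_plate hn hx
    refine ⟨i, fun m h1 h2 => ((S.mem_plate_iff i hx).1 hi m).lt_of_ne fun h0 => h ?_⟩
    exact Set.mem_iUnion.2 ⟨i, hi, m, h1, h2, sub_eq_zero.1 h0.symm⟩
  · rintro ⟨i, hi⟩ h
    obtain ⟨j, hj, m, h1, h2, h3⟩ := Set.mem_iUnion.1 h
    obtain rfl := S.eq_of_mem_strictPlate_of_mem_plate hi hj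
    exact (hi m h1 h2).ne' (sub_eq_zero.2 h3)

/-- A linear form of a proper cyclic union of blocks takes the value `1` on some root. -/
lemma exists_coordForm_ne_zero (S : DecoratedOSP n k ℓ) (i : Fin ℓ) {m : ℕ} (h1 : 1 ≤ m)
    (h2 : m < ℓ) : ∃ w : Fin n → ℝ, ∑ a, w a = 0 ∧ S.coordForm i m w ≠ 0 := by
  obtain ⟨a, ha⟩ := S.block_nonempty i
  obtain ⟨b, hb⟩ := S.block_nonempty (cyc i m)
  have key : ∀ j c, c ∈ S.block j → ∀ j', (∑ a' ∈ S.block j', (Pi.single c (1 : ℝ) : Fin n → ℝ) a')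
      = if j' = j then 1 else 0 := by
    intro j c hc j'
    simp only [Pi.single_apply]
    rw [Finset.sum_ite_eq']
    refine if_congr ⟨fun h => ?_, fun h => h ▸ hc⟩ rfl rfl
    by_contra hne
    exact Finset.disjoint_left.1 (S.block_disjoint _ _ hne) h hc
  refine ⟨Pi.single a 1 - Pi.single b 1, by simp [Finset.sum_sub_distrib], ?_⟩
  have e1 : S.coordForm i m (Pi.single a 1) = 1 := by
    simp only [coordForm, LinearMap.sum_apply, LinearMap.proj_apply, key i a ha]
    rw [Finset.sum_eq_single 0]
    · simp [cyc_zero]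
    · intro t ht h0
      rw [if_neg]
      intro h
      rw [← cyc_zero i, cyc_cyc, zero_add] at h
      exact h0 (cyc_injOn i ((Finset.mem_range.1 ht).trans h2) i.pos h)
    · simp; omega
  have e2 : S.coordForm i m (Pi.single b 1) = 0 := by
    simp only [coordForm, LinearMap.sum_apply, LinearMap.proj_apply, key _ b hb]
    refine Finset.sum_eq_zero fun t ht => if_neg fun h => ?_
    have := Finset.mem_range.1 ht
    exact this.ne (cyc_injOn i (this.trans h2) h2 h)
  rw [map_sub, e1, e2]
  norm_num

end DecoratedOSP

/-! ### Full-dimensional sets in the hyperplane, and convexity of the hypersimplex -/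

lemma finrank_ker_sum {n : ℕ} (hn : 0 < n) :
    Module.finrank ℝ (LinearMap.ker (∑ i : Fin n, LinearMap.proj (R := ℝ) (φ := fun _ => ℝ) i)) + 1
      = n := by
  have h : (∑ i : Fin n, LinearMap.proj (R := ℝ) (φ := fun _ => ℝ) i) ≠ 0 := by
    intro h
    have := LinearMap.congr_fun h (Pi.single ⟨0, hn⟩ 1)
    simp [LinearMap.sum_apply] at this
  have := Module.Dual.finrank_ker_add_one_of_ne_zero (f := (∑ i : Fin n,
    LinearMap.proj (R := ℝ) (φ := fun _ => ℝ) i : Module.Dual ℝ (Fin n → ℝ))) h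
  simpa using this

lemma vectorSpan_le_ker {n : ℕ} {R : Set (Fin n → ℝ)} {φ : (Fin n → ℝ) →ₗ[ℝ] ℝ} {c : ℝ}
    (h : ∀ x ∈ R, φ x = c) : vectorSpan ℝ R ≤ LinearMap.ker φ := by
  refine Submodule.span_le.2 ?_
  rintro _ ⟨x, hx, y, hy, rfl⟩
  simp [h x hx, h y hy]

/-- The span of differences of a full-dimensional set in the hyperplane is, by dimension, all
vectors of coordinate sum zero. A facet inequality therefore cannot be an equality throughout such a
set. -/
lemma IsFullDim.apply_eq_zero {n : ℕ} (hn : 0 < n) {R : Set (Fin n → ℝ)} {c : ℝ}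
    (hR : IsFullDim R) (hsum : ∀ x ∈ R, ∑ i, x i = c) {φ : (Fin n → ℝ) →ₗ[ℝ] ℝ} {d : ℝ}
    (hφ : ∀ x ∈ R, φ x = d) {w : Fin n → ℝ} (hw : ∑ i, w i = 0) : φ w = 0 := by
  have h1 := vectorSpan_le_ker (R := R)
    (φ := ∑ i : Fin n, LinearMap.proj (R := ℝ) (φ := fun _ => ℝ) i) (c := c)
    (by simpa [LinearMap.sum_apply] using hsum)
  have h2 := Submodule.eq_of_le_of_finrank_eq h1 (by
    have := finrank_ker_sum hn
    unfold IsFullDim at hR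
    omega)
  have h3 := vectorSpan_le_ker hφ
  rw [h2] at h3
  exact h3 (by simpa [LinearMap.sum_apply] using hw)

lemma isFullDim_of_isOpen {n : ℕ} (hn : 0 < n) {R U : Set (Fin n → ℝ)} {c : ℝ}
    (hsum : ∀ x ∈ R, ∑ i, x i = c) (hU : IsOpen U) {z : Fin n → ℝ} (hz : z ∈ U)
    (hzc : ∑ i, z i = c) (hUR : ∀ x ∈ U, ∑ i, x i = c → x ∈ R) : IsFullDim R := by
  have h1 := vectorSpan_le_ker (R := R)
    (φ := ∑ i : Fin n, LinearMap.proj (R := ℝ) (φ := fun _ => ℝ) i) (c := c)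
    (by simpa [LinearMap.sum_apply] using hsum)
  have h2 : LinearMap.ker (∑ i : Fin n, LinearMap.proj (R := ℝ) (φ := fun _ => ℝ) i)
      ≤ vectorSpan ℝ R := by
    intro w hw
    have hw : ∑ i, w i = 0 := by simpa [LinearMap.sum_apply] using hw
    have hcont : Filter.Tendsto (fun t : ℝ => z + t • w) (𝓝[>] 0) (𝓝 z) := by
      have : Continuous fun t : ℝ => z + t • w := by fun_prop
      simpa using (this.tendsto 0).mono_left nhdsWithin_le_nhds
    obtain ⟨t, ht, ht0⟩ := ((hcont.eventually (hU.mem_nhds hz)).and self_mem_nhdsWithin).exists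
    have ht0 : 0 < t := ht0
    have m1 : z + t • w ∈ R := hUR _ ht (by
      simp [Finset.sum_add_distrib, ← Finset.mul_sum, hw, hzc])
    have := vsub_mem_vectorSpan ℝ m1 (hUR z hz hzc)
    have h := (vectorSpan ℝ R).smul_mem t⁻¹ this
    simpa [smul_smul, ht0.ne'] using h
  have := finrank_ker_sum hn
  unfold IsFullDim
  rwa [le_antisymm h1 h2]

lemma IsFullDim.nonempty {n : ℕ} (hn : 1 < n) {R : Set (Fin n → ℝ)} (hR : IsFullDim R) :
    R.Nonempty := by
  by_contra h
  rw [Set.not_nonempty_iff_eq_empty] at h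
  rw [h, IsFullDim, vectorSpan_empty, finrank_bot] at hR
  omega

/-- Repeated midpoints preserve every strict inequality already achieved, since the functions are
nonnegative on `C`. -/
lemma exists_forall_pos {E ι : Type*} [AddCommGroup E] [Module ℝ E] {C : Set E}
    (hC : Convex ℝ C) (hne : C.Nonempty) (φ : ι → E → ℝ)
    (hφ : ∀ i x y, φ i ((1 / 2 : ℝ) • x + (1 / 2 : ℝ) • y) = (φ i x + φ i y) / 2)
    (h0 : ∀ i, ∀ x ∈ C, 0 ≤ φ i x) (s : Finset ι) (hpos : ∀ i ∈ s, ∃ x ∈ C, 0 < φ i x) :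
    ∃ x ∈ C, ∀ i ∈ s, 0 < φ i x := by
  classical
  induction s using Finset.induction_on with
  | empty => obtain ⟨x, hx⟩ := hne; exact ⟨x, hx, by simp⟩
  | insert a s _ ih =>
    obtain ⟨x, hx, h1⟩ := ih fun i hi => hpos i (Finset.mem_insert_of_mem hi)
    obtain ⟨y, hy, h2⟩ := hpos a (Finset.mem_insert_self _ _)
    refine ⟨_, hC hx hy (by norm_num : (0 : ℝ) ≤ 1 / 2) (by norm_num : (0 : ℝ) ≤ 1 / 2)
      (by norm_num), fun i hi => ?_⟩
    rw [hφ]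
    rcases Finset.mem_insert.1 hi with rfl | hi
    · linarith [h0 i x hx]
    · linarith [h0 i y hy, h1 i hi]

lemma convex_hypersimplex (k n : ℕ) : Convex ℝ (hypersimplex k n) := by
  rintro x ⟨hx, hxs⟩ y ⟨hy, hys⟩ a b ha hb hab
  refine ⟨fun i => ?_, ?_⟩
  · simp only [Pi.add_apply, Pi.smul_apply, smul_eq_mul]
    constructor
    · have := (hx i).1; have := (hy i).1; positivity
    · nlinarith [(hx i).2, (hy i).2]
  · simp only [Pi.add_apply, Pi.smul_apply, smul_eq_mul, Finset.sum_add_distrib,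
      ← Finset.mul_sum, hxs, hys]
    linear_combination (k : ℝ) * hab

lemma isClosed_hypersimplex (k n : ℕ) : IsClosed (hypersimplex k n) := by
  have : hypersimplex k n =
      (⋂ i, {x : Fin n → ℝ | 0 ≤ x i} ∩ {x | x i ≤ 1}) ∩ {x | ∑ i, x i = (k : ℝ)} := by
    ext x; simp [hypersimplex]
  rw [this]
  exact (isClosed_iInter fun i => (isClosed_le (by fun_prop) (by fun_prop)).inter
    (isClosed_le (by fun_prop) (by fun_prop))).inter (isClosed_eq (by fun_prop) (by fun_prop))

/-- The open unit cube. -/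
def openCube (n : ℕ) : Set (Fin n → ℝ) := {x | ∀ i, 0 < x i ∧ x i < 1}

lemma isOpen_openCube (n : ℕ) : IsOpen (openCube n) := by
  have : openCube n = ⋂ i, {x : Fin n → ℝ | 0 < x i} ∩ {x | x i < 1} := by
    ext x; simp [openCube]
  rw [this]
  exact isOpen_iInter_of_finite fun i => (isOpen_lt (by fun_prop) (by fun_prop)).inter
    (isOpen_lt (by fun_prop) (by fun_prop))

lemma openHypersimplex_subset (k n : ℕ) : openHypersimplex k n ⊆ hypersimplex k n :=
  fun _ hx => ⟨fun i => ⟨(hx.1 i).1.le, (hx.1 i).2.le⟩, hx.2⟩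

lemma openSegment_mem_openHypersimplex {k n : ℕ} {x y : Fin n → ℝ} (hx : x ∈ hypersimplex k n)
    (hy : y ∈ openHypersimplex k n) {t : ℝ} (h0 : 0 < t) (h1 : t ≤ 1) :
    (1 - t) • x + t • y ∈ openHypersimplex k n := by
  refine ⟨fun i => ?_, (convex_hypersimplex k n hx (openHypersimplex_subset k n hy)
    (by linarith) h0.le (by ring)).2⟩
  simp only [Pi.add_apply, Pi.smul_apply, smul_eq_mul]
  have := hx.1 i
  have := hy.1 i
  constructor
  · nlinarith
  · nlinarith

lemma convex_openHypersimplex (k n : ℕ) : Convex ℝ (openHypersimplex k n) := by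
  intro x hx y hy a b ha hb hab
  rcases hb.eq_or_lt with rfl | hb
  · have : a = 1 := by linarith
    simpa [this] using hx
  · obtain rfl : a = 1 - b := by linarith
    exact openSegment_mem_openHypersimplex (openHypersimplex_subset k n hx) hy hb (by linarith)

/-! ### Recovering the cells from the blade -/

namespace DecoratedOSP

variable {n k ℓ ℓ' : ℕ}

/-- A cell containing an `(n-1)`-dimensional set has an interior point. -/
lemma exists_mem_strictPlate (S : DecoratedOSP n k ℓ) (i : Fin ℓ) (hn : 1 < n)
    {R : Set (Fin n → ℝ)} (hR : IsFullDim R) (hRi : R ⊆ S.plate i ∩ hypersimplex k n) :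
    ∃ x ∈ openHypersimplex k n, x ∈ S.strictPlate i := by
  have hsum : ∀ x ∈ R, ∑ a, x a = (k : ℝ) := fun x hx => (hRi hx).1.1
  have hne : (S.plate i ∩ hypersimplex k n).Nonempty := (hR.nonempty hn).mono hRi
  have hproj : ∀ (a : Fin n) (d : ℝ), ∃ x ∈ R, x a ≠ d := by
    intro a d
    by_contra! h
    have : Nontrivial (Fin n) := Fin.nontrivial_iff_two_le.2 hn
    obtain ⟨b, hb⟩ := exists_ne a
    have := hR.apply_eq_zero (by omega) hsum (φ := LinearMap.proj a) (d := d) h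
      (w := Pi.single a 1 - Pi.single b 1) (by simp [Finset.sum_sub_distrib])
    simp [hb.symm] at this
  obtain ⟨x, hx, hpos⟩ := exists_forall_pos ((S.convex_plate i).inter (convex_hypersimplex k n))
    hne (ι := Fin ℓ ⊕ Fin n ⊕ Fin n)
    (Sum.elim (fun m x => S.height i m x) (Sum.elim (fun a x => x a) (fun a x => 1 - x a)))
    (by
      rintro (m | a | a) x y
      · simp only [Sum.elim_inl, height_combo _ _ _ x y (by norm_num : (1 / 2 : ℝ) + 1 / 2 = 1)]
        ring
      · simp; ring
      · simp; ring)
    (by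
      rintro (m | a | a) x hx
      · exact (S.mem_plate_iff i hx.1.1).1 hx.1 m
      · exact (hx.2.1 a).1
      · exact sub_nonneg.2 (hx.2.1 a).2)
    -- The index `m = 0` is left out because its height is identically zero.
    (Finset.univ.filter fun s => ∀ m : Fin ℓ, s = Sum.inl m → 1 ≤ (m : ℕ))
    (by
      rintro (m | a | a) hs
      · have hm : 1 ≤ (m : ℕ) := by simpa using hs
        by_contra! h
        obtain ⟨w, hw, hne⟩ := S.exists_coordForm_ne_zero i hm m.2
        refine hne (hR.apply_eq_zero (by omega) hsum (d := S.partialWeight i m)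
          (fun x hx => ?_) hw)
        have h1 := h x (hRi hx)
        have h2 := (S.mem_plate_iff i (hsum x hx)).1 (hRi hx).1 m
        simp only [Sum.elim_inl, height_eq_coordForm] at h1 h2
        linarith
      · obtain ⟨x, hx, h⟩ := hproj a 0
        exact ⟨x, hRi hx, ((hRi hx).2.1 a).1.lt_of_ne' h⟩
      · obtain ⟨x, hx, h⟩ := hproj a 1
        exact ⟨x, hRi hx, sub_pos.2 (((hRi hx).2.1 a).2.lt_of_ne h)⟩)
  refine ⟨x, ⟨fun a => ⟨?_, ?_⟩, hx.1.1⟩, fun m h1 h2 => ?_⟩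
  · simpa using hpos (Sum.inr (Sum.inl a)) (by simp)
  · simpa using hpos (Sum.inr (Sum.inr a)) (by simp)
  · exact hpos (Sum.inl ⟨m, h2⟩) (by simpa using h1)

lemma segment_mem_strictPlate (S : DecoratedOSP n k ℓ) (i : Fin ℓ) {x y : Fin n → ℝ}
    (hx : x ∈ S.plate i) (hy : y ∈ S.strictPlate i) {t : ℝ} (h0 : 0 < t) (h1 : t ≤ 1) :
    (1 - t) • x + t • y ∈ S.strictPlate i := by
  intro m hm hm'
  rw [height_combo _ _ _ _ _ (by ring)]
  have := (S.mem_plate_iff i hx.1).1 hx m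
  have := hy m hm hm'
  have : 0 ≤ 1 - t := by linarith
  positivity

lemma cell_eq_closure (S : DecoratedOSP n k ℓ) (i : Fin ℓ)
    (h : (openHypersimplex k n ∩ S.strictPlate i).Nonempty) :
    S.plate i ∩ hypersimplex k n = closure (openHypersimplex k n ∩ S.strictPlate i) := by
  apply subset_antisymm
  · rintro x ⟨hx, hxΔ⟩
    obtain ⟨y, hyΔ, hy⟩ := h
    have hcont : Filter.Tendsto (fun t : ℝ => (1 - t) • x + t • y) (𝓝[>] 0) (𝓝 x) := by
      have : Continuous fun t : ℝ => (1 - t) • x + t • y := by fun_prop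
      simpa using (this.tendsto 0).mono_left nhdsWithin_le_nhds
    refine mem_closure_of_tendsto hcont ?_
    filter_upwards [Ioc_mem_nhdsGT (zero_lt_one' ℝ)] with t ht
    exact ⟨openSegment_mem_openHypersimplex hxΔ hyΔ ht.1 ht.2,
      S.segment_mem_strictPlate i hx hy ht.1 ht.2⟩
  · refine closure_minimal ?_ ((S.isClosed_plate i).inter (isClosed_hypersimplex k n))
    exact fun x hx => ⟨S.strictPlate_subset_plate i hx.1.2 hx.2, openHypersimplex_subset k n hx.1⟩

/-- The regions cut out by a blade depend only on the blade. -/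
lemma region_subset (S : DecoratedOSP n k ℓ) (S' : DecoratedOSP n k ℓ') (hn : 0 < n)
    (h : S.blade ∩ openHypersimplex k n = S'.blade ∩ openHypersimplex k n) {i : Fin ℓ}
    {j : Fin ℓ'} {x : Fin n → ℝ} (hx : x ∈ openHypersimplex k n) (hi : x ∈ S.strictPlate i)
    (hj : x ∈ S'.strictPlate j) :
    openHypersimplex k n ∩ S.strictPlate i ⊆ openHypersimplex k n ∩ S'.strictPlate j := by
  have hpre : IsPreconnected (openHypersimplex k n ∩ S.strictPlate i) :=
    ((convex_openHypersimplex k n).inter (S.convex_strictPlate i)).isPreconnected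
  refine Set.subset_inter Set.inter_subset_left ?_
  have hsub : openHypersimplex k n ∩ S.strictPlate i ⊆ ⋃ j', S'.strictPlate j' := by
    rintro y ⟨hyΔ, hy⟩
    have h1 : y ∉ S'.blade := fun hb =>
      (S.notMem_blade_iff hn hyΔ.2).2 ⟨i, hy⟩ (h.symm.subset ⟨hb, hyΔ⟩).1
    exact Set.mem_iUnion.2 ((S'.notMem_blade_iff hn hyΔ.2).1 h1)
  intro y hy
  by_contra hyj
  obtain ⟨j', hj'⟩ := Set.mem_iUnion.1 (hsub hy)
  have hne : j' ≠ j := fun e => hyj (e ▸ hj')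
  -- Connectedness: the region of `S` is covered by disjoint open strict plates of `S'`, so it
  -- cannot meet two of them.
  obtain ⟨z, ⟨hzΔ, -⟩, hzu, hzv⟩ := hpre (S'.strictPlate j) (⋃ (j' : Fin ℓ') (_ : j' ≠ j),
      S'.strictPlate j') (S'.isOpen_strictPlate j)
    (isOpen_iUnion fun j' => isOpen_iUnion fun _ => S'.isOpen_strictPlate j')
    (fun z hz => by
      obtain ⟨j₁, hj₁⟩ := Set.mem_iUnion.1 (hsub hz)
      by_cases e : j₁ = j
      · exact Or.inl (e ▸ hj₁)
      · exact Or.inr (Set.mem_biUnion e hj₁))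
    ⟨x, ⟨hx, hi⟩, hj⟩ ⟨y, hy, Set.mem_biUnion hne hj'⟩
  obtain ⟨j₁, hne₁, hj₁⟩ := Set.mem_iUnion₂.1 hzv
  exact hne₁ (S'.eq_of_mem_strictPlate_of_mem_plate hj₁
    (S'.strictPlate_subset_plate j hzΔ.2 hzu))

/-- A full-dimensional subset gives the cell an interior point, so the cell is the closure of a
region that both blades cut out. The subset `R` is essential: degenerate cells need not be visible
in the blade. -/
lemma mem_cells_of_blade_eq (S : DecoratedOSP n k ℓ) (S' : DecoratedOSP n k ℓ') (hn : 1 < n)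
    (h : S.blade ∩ openHypersimplex k n = S'.blade ∩ openHypersimplex k n)
    {P R : Set (Fin n → ℝ)} (hP : P ∈ S.cells) (hR : IsFullDim R) (hRP : R ⊆ P) :
    P ∈ S'.cells := by
  obtain ⟨i, rfl⟩ := hP
  obtain ⟨x, hxΔ, hx⟩ := S.exists_mem_strictPlate i hn hR hRP
  have hn0 : 0 < n := by omega
  have h1 : x ∉ S'.blade := fun hb =>
    (S.notMem_blade_iff hn0 hxΔ.2).2 ⟨i, hx⟩ (h.symm.subset ⟨hb, hxΔ⟩).1
  obtain ⟨j, hj⟩ := (S'.notMem_blade_iff hn0 hxΔ.2).1 h1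
  refine ⟨j, ?_⟩
  simp only
  rw [S.cell_eq_closure i ⟨x, hxΔ, hx⟩, S'.cell_eq_closure j ⟨x, hxΔ, hj⟩,
    (S.region_subset S' hn0 h hxΔ hx hj).antisymm (S'.region_subset S hn0 h.symm hxΔ hj hx)]

end DecoratedOSP

lemma commonRefinement_congr {n k a b a' b' : ℕ} (hn : 1 < n) (S : DecoratedOSP n k a)
    (S' : DecoratedOSP n k a') (T : DecoratedOSP n k b) (T' : DecoratedOSP n k b')
    (hS : S.blade ∩ openHypersimplex k n = S'.blade ∩ openHypersimplex k n)
    (hT : T.blade ∩ openHypersimplex k n = T'.blade ∩ openHypersimplex k n) :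
    commonRefinement S.cells T.cells = commonRefinement S'.cells T'.cells := by
  ext R
  constructor
  · rintro ⟨⟨P, hP, Q, hQ, rfl⟩, hR⟩
    exact ⟨⟨P, S.mem_cells_of_blade_eq S' hn hS hP hR Set.inter_subset_left, Q,
      T.mem_cells_of_blade_eq T' hn hT hQ hR Set.inter_subset_right, rfl⟩, hR⟩
  · rintro ⟨⟨P, hP, Q, hQ, rfl⟩, hR⟩
    exact ⟨⟨P, S'.mem_cells_of_blade_eq S hn hS.symm hP hR Set.inter_subset_left, Q,
      T'.mem_cells_of_blade_eq T hn hT.symm hQ hR Set.inter_subset_right, rfl⟩, hR⟩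

/-! ### Singleton partitions and counting paths -/

namespace DecoratedOSP

variable {n k : ℕ}

/-- The decorated ordered set partition into singletons `({σ₁}, …, {σ_n})` whose weights are given
by the indicator function of the `k`-element set `J`. -/
def ofSet (σ : Equiv.Perm (Fin n)) (J : Finset (Fin n)) (hJ : J.card = k) :
    DecoratedOSP n k n where
  block j := {σ j}
  weight j := if σ j ∈ J then 1 else 0
  block_nonempty j := Finset.singleton_nonempty _
  block_disjoint i j h := by simpa using h
  block_cover a := ⟨σ.symm a, by simp⟩
  weight_sum := by
    rw [Equiv.sum_comp σ fun a => if a ∈ J then (1 : ℤ) else 0]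
    simp [hJ]

lemma height_ofSet (σ : Equiv.Perm (Fin n)) (J : Finset (Fin n)) (hJ : J.card = k) (i : Fin n)
    (m : ℕ) (x : Fin n → ℝ) : (ofSet σ J hJ).height i m x =
      ∑ t ∈ Finset.range m, x (σ (cyc i t)) - ∑ t ∈ Finset.range m, eVec J (σ (cyc i t)) := by
  rw [height_eq_sum, ← Finset.sum_sub_distrib]
  simp [ofSet, eVec]

lemma height_singletons (σ : Equiv.Perm (Fin n)) (i : Fin n) (m : ℕ) (x : Fin n → ℝ) :
    (singletons σ).height i m x = ∑ t ∈ Finset.range m, x (σ (cyc i t)) := by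
  rw [height_eq_sum]
  simp [singletons]

lemma mem_plateBoundary_iff {ℓ : ℕ} (S : DecoratedOSP n k ℓ) (i : Fin ℓ) (x : Fin n → ℝ) :
    x ∈ S.plateBoundary i ↔ ∑ a, x a = (k : ℝ) ∧
      (∀ m, 1 ≤ m → m < ℓ → 0 ≤ S.height i m x) ∧ ∃ m, 1 ≤ m ∧ m < ℓ ∧ S.height i m x = 0 := by
  simp only [plateBoundary, plate, height, sub_nonneg, sub_eq_zero, Set.mem_ofPred_eq, and_assoc]

lemma sum_eVec (J : Finset (Fin n)) : ∑ a, eVec J a = (J.card : ℝ) := by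
  simp [eVec]

/-- Translating by `eVec J` raises each partial sum by the number of elements of `J` it meets, which
is the same as giving the singletons the indicator of `J` as weights. -/
lemma bladeAt_eq (σ : Equiv.Perm (Fin n)) (J : Finset (Fin n)) (hJ : J.card = k) :
    bladeAt σ J = (ofSet σ J hJ).blade := by
  have key : ∀ i x, x ∈ (singletons σ).plateBoundary i ↔
      x + eVec J ∈ (ofSet σ J hJ).plateBoundary i := by
    intro i x
    have : ∀ m, (ofSet σ J hJ).height i m (x + eVec J) = (singletons σ).height i m x := by
      intro m
      simp [height_ofSet, height_singletons, Finset.sum_add_distrib]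
    simp only [mem_plateBoundary_iff, this, Pi.add_apply, Finset.sum_add_distrib, sum_eVec, hJ,
      Nat.cast_zero, add_eq_right]
  ext y
  simp only [bladeAt, blade, Set.mem_image, Set.mem_iUnion]
  constructor
  · rintro ⟨x, ⟨i, hi⟩, rfl⟩
    exact ⟨i, (key i x).1 hi⟩
  · rintro ⟨i, hi⟩
    exact ⟨y - eVec J, ⟨i, (key _ _).2 (by simpa using hi)⟩, by simp⟩

lemma eVec_mem_hypersimplex {B : Finset (Fin n)} (hB : B.card = k) :
    eVec B ∈ hypersimplex k n := by
  refine ⟨fun i => ?_, by rw [sum_eVec, hB]⟩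
  unfold eVec
  split_ifs <;> norm_num

/-- The number of elements of `B` among the `m` elements that follow position `i` in `σ`. -/
def count (σ : Equiv.Perm (Fin n)) (i : Fin n) (B : Finset (Fin n)) (m : ℕ) : ℤ :=
  ∑ t ∈ Finset.range m, if σ (cyc i t) ∈ B then 1 else 0

lemma count_succ (σ : Equiv.Perm (Fin n)) (i : Fin n) (B : Finset (Fin n)) (m : ℕ) :
    count σ i B (m + 1) = count σ i B m + if σ (cyc i m) ∈ B then 1 else 0 :=
  Finset.sum_range_succ _ _

@[simp] lemma count_zero (σ : Equiv.Perm (Fin n)) (i : Fin n) (B : Finset (Fin n)) :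
    count σ i B 0 = 0 := rfl

lemma count_period (σ : Equiv.Perm (Fin n)) (i : Fin n) (B : Finset (Fin n)) :
    count σ i B n = B.card := by
  unfold count
  rw [sum_range_cyc i fun j => if σ j ∈ B then (1 : ℤ) else 0,
    Equiv.sum_comp σ fun a => if a ∈ B then (1 : ℤ) else 0]
  simp

lemma count_cast (σ : Equiv.Perm (Fin n)) (i : Fin n) (B : Finset (Fin n)) (m : ℕ) :
    ((count σ i B m : ℤ) : ℝ) = ∑ t ∈ Finset.range m, eVec B (σ (cyc i t)) := by
  simp [count, eVec]

lemma height_ofSet_eVec (σ : Equiv.Perm (Fin n)) (J : Finset (Fin n)) (hJ : J.card = k)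
    (i : Fin n) (m : ℕ) (B : Finset (Fin n)) :
    (ofSet σ J hJ).height i m (eVec B) = ((count σ i B m - count σ i J m : ℤ) : ℝ) := by
  rw [height_ofSet, Int.cast_sub, count_cast, count_cast]

lemma eVec_mem_plate_iff (σ : Equiv.Perm (Fin n)) (J : Finset (Fin n)) (hJ : J.card = k)
    (i : Fin n) (d : ℕ) {B : Finset (Fin n)} (hB : B.card = k) :
    eVec B ∈ (ofSet σ J hJ).plate (cyc i d) ↔
      ∀ m < n, count σ i B d - count σ i J d ≤ count σ i B m - count σ i J m := by
  rw [mem_plate_cyc_iff_lt _ _ _ (by rw [sum_eVec, hB])]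
  simp only [height_ofSet_eVec, Int.cast_le]

/-- The set whose counting function along `σ`, starting at position `i`, has the increments
of `G`. -/
def ofCount (σ : Equiv.Perm (Fin n)) (i : Fin n) (G : ℕ → ℤ) : Finset (Fin n) :=
  ((Finset.range n).filter fun t => G (t + 1) ≠ G t).image fun t => σ (cyc i t)

lemma mem_ofCount (σ : Equiv.Perm (Fin n)) (i : Fin n) (G : ℕ → ℤ) {t : ℕ} (ht : t < n) :
    σ (cyc i t) ∈ ofCount σ i G ↔ G (t + 1) ≠ G t := by
  simp only [ofCount, Finset.mem_image, Finset.mem_filter, Finset.mem_range]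
  constructor
  · rintro ⟨s, ⟨hs, h⟩, e⟩
    rwa [← cyc_injOn i hs ht (σ.injective e)]
  · exact fun h => ⟨t, ⟨ht, h⟩, rfl⟩

lemma count_ofCount (σ : Equiv.Perm (Fin n)) (i : Fin n) {G : ℕ → ℤ}
    (hG : ∀ t < n, G (t + 1) = G t ∨ G (t + 1) = G t + 1) {m : ℕ} (hm : m ≤ n) :
    count σ i (ofCount σ i G) m = G m - G 0 := by
  induction m with
  | zero => simp
  | succ m ih =>
    rw [count_succ, ih (by omega), if_congr (mem_ofCount σ i G hm) rfl rfl]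
    rcases hG m hm with h | h <;> simp [h]
    ring

lemma card_ofCount (σ : Equiv.Perm (Fin n)) (i : Fin n) {G : ℕ → ℤ}
    (hG : ∀ t < n, G (t + 1) = G t ∨ G (t + 1) = G t + 1) (hk : G n = G 0 + k) :
    (ofCount σ i G).card = k := by
  have := count_period σ i (ofCount σ i G)
  rw [count_ofCount σ i hG le_rfl, hk] at this
  omega

end DecoratedOSP

/-! ### Random rounding and integrality of the cells -/

lemma intervalIntegrable_fract_add (a u v : ℝ) :
    IntervalIntegrable (fun θ : ℝ => Int.fract (a + θ)) volume u v := by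
  refine (intervalIntegrable_const (c := (1 : ℝ))).mono_fun
    (measurable_fract.comp (measurable_const_add a)).aestronglyMeasurable
    (Filter.Eventually.of_forall fun θ => ?_)
  simp only [Real.norm_of_nonneg (Int.fract_nonneg (a + θ)), norm_one]
  exact (Int.fract_lt_one _).le

lemma integral_fract_add (a : ℝ) :
    ∫ θ in (0 : ℝ)..1, Int.fract (a + θ) = ∫ θ in (0 : ℝ)..1, Int.fract θ := by
  rw [intervalIntegral.integral_comp_add_left (fun θ => Int.fract θ) a]
  have h : Function.Periodic (Int.fract : ℝ → ℝ) 1 := Int.fract_periodic ℝ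
  have := h.intervalIntegral_add_eq a 0
  simpa using this

/-- Write the floor as the identity minus the fractional part; the latter has the same integral over
every period. Thus rounding is correct on average. -/
lemma integral_floor_add_sub (a b : ℝ) :
    ∫ θ in (0 : ℝ)..1, ((⌊b + θ⌋ : ℝ) - ⌊a + θ⌋) = b - a := by
  have : ∀ θ : ℝ, ((⌊b + θ⌋ : ℝ) - ⌊a + θ⌋) =
      (b - a) - (Int.fract (b + θ) - Int.fract (a + θ)) := by
    intro θ
    rw [← Int.self_sub_fract, ← Int.self_sub_fract]
    ring
  simp only [this]
  rw [intervalIntegral.integral_sub (by simp)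
      ((intervalIntegrable_fract_add _ _ _).sub (intervalIntegrable_fract_add _ _ _)),
    intervalIntegral.integral_sub (intervalIntegrable_fract_add _ _ _)
      (intervalIntegrable_fract_add _ _ _), integral_fract_add, integral_fract_add]
  simp

namespace DecoratedOSP

variable {n k : ℕ}

/-- The partial sums of `x` along `σ`, starting at position `i`. -/
def partialSum (σ : Equiv.Perm (Fin n)) (i : Fin n) (x : Fin n → ℝ) (m : ℕ) : ℝ :=
  ∑ t ∈ Finset.range m, x (σ (cyc i t))

lemma partialSum_period (σ : Equiv.Perm (Fin n)) (i : Fin n) (x : Fin n → ℝ) :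
    partialSum σ i x n = ∑ a, x a := by
  rw [partialSum, sum_range_cyc i fun j => x (σ j), Equiv.sum_comp σ x]

/-- The vertex set of `Δ_{k,n}` obtained by rounding the partial sums of `x` with offset `θ`. -/
noncomputable def round (σ : Equiv.Perm (Fin n)) (i : Fin n) (x : Fin n → ℝ) (θ : ℝ) : Finset (Fin n) :=
  ofCount σ i fun m => ⌊partialSum σ i x m + θ⌋

lemma round_step (σ : Equiv.Perm (Fin n)) (i : Fin n) {x : Fin n → ℝ}
    (hx : x ∈ hypersimplex k n) (θ : ℝ) (t : ℕ) :
    ⌊partialSum σ i x (t + 1) + θ⌋ = ⌊partialSum σ i x t + θ⌋ ∨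
      ⌊partialSum σ i x (t + 1) + θ⌋ = ⌊partialSum σ i x t + θ⌋ + 1 := by
  have h := hx.1 (σ (cyc i t))
  have h1 : ⌊partialSum σ i x t + θ⌋ ≤ ⌊partialSum σ i x (t + 1) + θ⌋ := by
    refine Int.floor_le_floor ?_
    rw [partialSum, partialSum, Finset.sum_range_succ]
    linarith
  have h2 : ⌊partialSum σ i x (t + 1) + θ⌋ ≤ ⌊partialSum σ i x t + θ⌋ + 1 := by
    rw [← Int.floor_add_one]
    refine Int.floor_le_floor ?_
    rw [partialSum, partialSum, Finset.sum_range_succ]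
    linarith
  omega

lemma card_round (σ : Equiv.Perm (Fin n)) (i : Fin n) {x : Fin n → ℝ}
    (hx : x ∈ hypersimplex k n) (θ : ℝ) : (round σ i x θ).card = k := by
  refine card_ofCount σ i (fun t _ => round_step σ i hx θ t) ?_
  rw [partialSum_period, hx.2, add_comm (k : ℝ), Int.floor_add_natCast]
  simp [partialSum]

/-- The inequalities of a plate bound differences of partial sums by integers. The floor is monotone
and commutes with integer shifts, so rounding preserves them. -/
lemma eVec_round_mem_plate (σ : Equiv.Perm (Fin n)) (i : Fin n) {J : Finset (Fin n)}
    (hJ : J.card = k) {x : Fin n → ℝ} (hx : x ∈ hypersimplex k n) (θ : ℝ) {j : Fin n}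
    (hxj : x ∈ (ofSet σ J hJ).plate j) : eVec (round σ i x θ) ∈ (ofSet σ J hJ).plate j := by
  obtain ⟨d, hd, rfl⟩ := exists_cyc_eq i j
  rw [eVec_mem_plate_iff _ _ _ _ _ (card_round σ i hx θ)]
  rw [mem_plate_cyc_iff _ _ _ hx.2] at hxj
  intro m hm
  have h := hxj m
  rw [height_ofSet, height_ofSet, ← count_cast, ← count_cast] at h
  rw [round, count_ofCount σ i (fun t _ => round_step σ i hx θ t) hm.le,
    count_ofCount σ i (fun t _ => round_step σ i hx θ t) hd.le]
  have h1 : ⌊partialSum σ i x d + θ⌋ ≤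
      ⌊partialSum σ i x m + θ⌋ + (count σ i J d - count σ i J m) := by
    rw [← Int.floor_add_intCast]
    refine Int.floor_le_floor ?_
    push_cast
    unfold partialSum
    linarith
  omega

lemma eVec_round_apply (σ : Equiv.Perm (Fin n)) (i : Fin n) {x : Fin n → ℝ}
    (hx : x ∈ hypersimplex k n) (θ : ℝ) {t : ℕ} (ht : t < n) :
    eVec (round σ i x θ) (σ (cyc i t)) =
      (⌊partialSum σ i x (t + 1) + θ⌋ : ℝ) - ⌊partialSum σ i x t + θ⌋ := by
  rw [eVec, round, if_congr (mem_ofCount σ i _ ht) rfl rfl]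
  rcases round_step σ i hx θ t with h | h <;> simp [h]

/-- A point of an alcoved polytope is an average of vertices obtained by rounding. -/
lemma mem_convexHull_round (σ : Equiv.Perm (Fin n)) (i : Fin n) {x : Fin n → ℝ}
    (hx : x ∈ hypersimplex k n) {V : Set (Fin n → ℝ)} (hV : V.Finite)
    (h : ∀ θ, eVec (round σ i x θ) ∈ V) : x ∈ convexHull ℝ V := by
  let μ : Measure ℝ := volume.restrict (Set.Ioc 0 1)
  have : IsProbabilityMeasure μ := ⟨by simp [μ]⟩
  have hf : ∀ a, ∃ t < n, a = σ (cyc i t) := fun a => by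
    obtain ⟨t, ht, h⟩ := exists_cyc_eq i (σ.symm a)
    exact ⟨t, ht, by simp [h]⟩
  have hint : ∀ a, Integrable (fun θ => eVec (round σ i x θ) a) μ := by
    intro a
    obtain ⟨t, ht, rfl⟩ := hf a
    refine (integrable_const (1 : ℝ)).mono' ?_ (Filter.Eventually.of_forall fun θ => ?_)
    · simp only [eVec_round_apply σ i hx _ ht]
      have hm : ∀ c : ℝ, Measurable fun θ : ℝ => ((⌊c + θ⌋ : ℤ) : ℝ) := fun c =>
        (measurable_of_countable (fun z : ℤ => (z : ℝ))).comp
          (Int.measurable_floor.comp (measurable_const_add c))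
      exact ((hm _).sub (hm _)).aestronglyMeasurable
    · unfold eVec
      split_ifs <;> simp
  have key : ∫ θ, eVec (round σ i x θ) ∂μ = x := by
    funext a
    rw [eval_integral hint]
    obtain ⟨t, ht, rfl⟩ := hf a
    simp only [eVec_round_apply σ i hx _ ht]
    have := integral_floor_add_sub (partialSum σ i x t) (partialSum σ i x (t + 1))
    rw [intervalIntegral.integral_of_le zero_le_one] at this
    rw [this, partialSum, partialSum, Finset.sum_range_succ]
    ring
  rw [← key]
  exact (convex_convexHull ℝ V).integral_mem (hV.isClosed_convexHull ℝ)
    (Filter.Eventually.of_forall fun θ => subset_convexHull ℝ V (h θ)) (Integrable.of_eval hint)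

/-- Every cell of the common refinement is the convex hull of the vertices `e_B` it contains. -/
lemma cell_eq_convexHull (σ : Equiv.Perm (Fin n)) {J₁ J₂ : Finset (Fin n)} (hJ₁ : J₁.card = k)
    (hJ₂ : J₂.card = k) (p q : Fin n) :
    ((ofSet σ J₁ hJ₁).plate p ∩ hypersimplex k n) ∩ ((ofSet σ J₂ hJ₂).plate q ∩ hypersimplex k n)
      = convexHull ℝ {x | ∃ B : Finset (Fin n), (B.card = k ∧ eVec B ∈ (ofSet σ J₁ hJ₁).plate p ∧
          eVec B ∈ (ofSet σ J₂ hJ₂).plate q) ∧ x = eVec B} := by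
  apply subset_antisymm
  · rintro x ⟨⟨h1, hx⟩, h2, -⟩
    refine mem_convexHull_round σ p hx ?_ fun θ => ⟨_, ⟨card_round σ p hx θ,
      eVec_round_mem_plate σ p hJ₁ hx θ h1, eVec_round_mem_plate σ p hJ₂ hx θ h2⟩, rfl⟩
    refine (Set.finite_range (eVec (n := n))).subset ?_
    rintro _ ⟨B, -, rfl⟩
    exact ⟨B, rfl⟩
  · refine convexHull_min ?_ (((convex_plate _ p).inter (convex_hypersimplex k n)).inter
      ((convex_plate _ q).inter (convex_hypersimplex k n)))
    rintro _ ⟨B, ⟨hB, h1, h2⟩, rfl⟩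
    exact ⟨⟨h1, eVec_mem_hypersimplex hB⟩, h2, eVec_mem_hypersimplex hB⟩

end DecoratedOSP

/-! ### The common refinement is a polytopal subdivision -/

namespace DecoratedOSP

variable {n k : ℕ}

lemma eventually_add_mul_ne_zero (a : ℝ) {b : ℝ} (hb : b ≠ 0) :
    ∀ᶠ ε : ℝ in 𝓝[>] 0, a + ε * b ≠ 0 := by
  have h : ∀ᶠ ε : ℝ in 𝓝[>] 0, ε ≠ -a / b := by
    by_cases ha : -a / b = 0
    · filter_upwards [self_mem_nhdsWithin] with ε hε
      rw [ha]
      exact ne_of_gt hε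
    · exact nhdsWithin_le_nhds (isOpen_ne.mem_nhds (Ne.symm ha))
  filter_upwards [h] with ε hε h0
  apply hε
  field_simp
  linarith

/-- There is an interior point of `Δ_{k,n}` whose heights are pairwise distinct. -/
lemma exists_generic (σ : Equiv.Perm (Fin n)) (i : Fin n) (hk : 1 ≤ k) (hkn : k < n)
    {J₁ J₂ : Finset (Fin n)} (hJ₁ : J₁.card = k) (hJ₂ : J₂.card = k) :
    ∃ y ∈ openHypersimplex k n, ∀ r s : Fin n, r ≠ s →
      (ofSet σ J₁ hJ₁).height i r y ≠ (ofSet σ J₁ hJ₁).height i s y ∧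
      (ofSet σ J₂ hJ₂).height i r y ≠ (ofSet σ J₂ hJ₂).height i s y := by
  have hn : (0 : ℝ) < n := by exact_mod_cast (by omega : 0 < n)
  let last : Fin n := ⟨n - 1, by omega⟩
  -- A direction of coordinate sum zero whose partial sum at each `r < n` is `r`. Moving the
  -- barycentre `u` slightly along it separates all heights.
  let v : Fin n → ℝ := fun a => 1 - (n : ℝ) * (Pi.single (σ (cyc i last)) 1 : Fin n → ℝ) a
  let u : Fin n → ℝ := fun _ => (k : ℝ) / n
  have hv : ∑ a, v a = 0 := by simp [v, Finset.sum_sub_distrib, ← Finset.mul_sum]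
  have hvr : ∀ r : Fin n, ∑ t ∈ Finset.range r, v (σ (cyc i t)) = r := by
    intro r
    have : ∀ t ∈ Finset.range r, v (σ (cyc i t)) = 1 := by
      intro t ht
      have ht := Finset.mem_range.1 ht
      have hne : σ (cyc i t) ≠ σ (cyc i last) := by
        intro h
        have := cyc_injOn i (ht.trans r.2) last.2 (σ.injective h)
        have hr := r.2
        simp only [last] at this
        omega
      simp [v, hne]
    rw [Finset.sum_congr rfl this]
    simp
  have hdiff : ∀ (J : Finset (Fin n)) (hJ : J.card = k) (r s : Fin n) (ε : ℝ),
      (ofSet σ J hJ).height i r (u + ε • v) - (ofSet σ J hJ).height i s (u + ε • v) =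
      ((ofSet σ J hJ).height i r u - (ofSet σ J hJ).height i s u) + ε * ((r : ℝ) - s) := by
    intro J hJ r s ε
    simp only [height_ofSet, Pi.add_apply, Pi.smul_apply, smul_eq_mul, Finset.sum_add_distrib,
      ← Finset.mul_sum, hvr]
    ring
  have hu : u ∈ openCube n := fun a =>
    ⟨div_pos (by exact_mod_cast hk) hn, (div_lt_one hn).2 (by exact_mod_cast hkn)⟩
  have hcont : Filter.Tendsto (fun t : ℝ => u + t • v) (𝓝[>] 0) (𝓝 u) := by
    have : Continuous fun t : ℝ => u + t • v := by fun_prop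
    simpa using (this.tendsto 0).mono_left nhdsWithin_le_nhds
  have hev : ∀ (J : Finset (Fin n)) (hJ : J.card = k), ∀ᶠ ε : ℝ in 𝓝[>] 0, ∀ r s : Fin n,
      r ≠ s → (ofSet σ J hJ).height i r (u + ε • v) ≠ (ofSet σ J hJ).height i s (u + ε • v) := by
    intro J hJ
    simp only [Filter.eventually_all]
    intro r s hrs
    have hb : (r : ℝ) - s ≠ 0 := by
      rw [sub_ne_zero]
      exact_mod_cast fun h => hrs (Fin.ext h)
    filter_upwards [eventually_add_mul_ne_zero ((ofSet σ J hJ).height i r u -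
      (ofSet σ J hJ).height i s u) hb] with ε hε h
    rw [← hdiff, h, sub_self] at hε
    exact hε rfl
  obtain ⟨ε, ⟨h1, h2⟩, h3⟩ := (((hev J₁ hJ₁).and (hev J₂ hJ₂)).and
    (hcont.eventually ((isOpen_openCube n).mem_nhds hu))).exists
  refine ⟨u + ε • v, ⟨h3, ?_⟩, fun r s hrs => ⟨h1 r s hrs, h2 r s hrs⟩⟩
  simp only [Pi.add_apply, Pi.smul_apply, smul_eq_mul, Finset.sum_add_distrib, ← Finset.mul_sum,
    hv, u]
  simp
  field_simp

/-- Choosing the plate containing `x` lexicographically, with ties broken by a generic point `y`,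
small movements from `x` towards `y` stay in the strict plate. -/
lemma exists_mem_plate_eventually {ℓ : ℕ} (S : DecoratedOSP n k ℓ) (i : Fin ℓ) {x y : Fin n → ℝ}
    (hx : ∑ a, x a = (k : ℝ)) (hy : ∑ a, y a = (k : ℝ))
    (hxy : ∀ r s : Fin ℓ, r ≠ s → S.height i r y ≠ S.height i s y) :
    ∃ p, x ∈ S.plate p ∧ ∀ᶠ t : ℝ in 𝓝[>] 0, (1 - t) • x + t • y ∈ S.strictPlate p := by
  obtain ⟨d, -, hd⟩ := Finset.exists_min_image Finset.univ
    -- Near `x`, on the segment to `y`, heights are ordered by their value at `x`, with ties decided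
    -- by their value at `y`.
    (fun r : Fin ℓ => toLex (S.height i r x, S.height i r y)) ⟨i, Finset.mem_univ i⟩
  have hle : ∀ r : Fin ℓ, S.height i d x < S.height i r x ∨
      S.height i d x = S.height i r x ∧ S.height i d y ≤ S.height i r y := fun r => by
    simpa [Prod.Lex.toLex_le_toLex] using hd r (Finset.mem_univ r)
  refine ⟨cyc i d, (S.mem_plate_cyc_iff_lt i d hx).2 fun m hm => ?_, ?_⟩
  · rcases hle ⟨m, hm⟩ with h | h
    · exact h.le
    · exact h.1.le
  · have key : ∀ᶠ t : ℝ in 𝓝[>] 0, ∀ r : Fin ℓ, r ≠ d →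
        S.height i d ((1 - t) • x + t • y) < S.height i r ((1 - t) • x + t • y) := by
      simp only [Filter.eventually_all]
      intro r hr
      rcases hle r with h | ⟨h, h'⟩
      · have hc : ∀ m, Filter.Tendsto (fun t : ℝ => S.height i m ((1 - t) • x + t • y)) (𝓝[>] 0)
            (𝓝 (S.height i m x)) := by
          intro m
          have : Continuous fun t : ℝ => S.height i m ((1 - t) • x + t • y) :=
            (S.continuous_height i m).comp (by fun_prop)
          simpa using (this.tendsto 0).mono_left nhdsWithin_le_nhds
        exact (hc d).eventually_lt (hc r) h
      · have h' := h'.lt_of_ne (hxy d r hr.symm)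
        filter_upwards [self_mem_nhdsWithin] with t ht
        have ht : 0 < t := ht
        rw [height_combo _ _ _ _ _ (by ring), height_combo _ _ _ _ _ (by ring), h]
        gcongr
    filter_upwards [key] with t ht m h1 h2
    have hsum : ∑ a, ((1 - t) • x + t • y) a = (k : ℝ) := by
      simp only [Pi.add_apply, Pi.smul_apply, smul_eq_mul, Finset.sum_add_distrib,
        ← Finset.mul_sum, hx, hy]
      ring
    have h3 := S.height_add i d m ((1 - t) • x + t • y)
    rw [← height_mod _ _ _ hsum] at h3
    have h4 := ht ⟨(d + m) % ℓ, Nat.mod_lt _ i.pos⟩ (by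
      intro e
      have e := congrArg Fin.val e
      simp only at e
      have : (d : ℕ) + m ≡ d + 0 [MOD ℓ] := by
        simpa [Nat.ModEq, Nat.mod_eq_of_lt d.2] using e
      have := Nat.ModEq.add_left_cancel' _ this
      rw [Nat.ModEq, Nat.mod_eq_of_lt h2, Nat.zero_mod] at this
      omega)
    simp only at h4
    linarith

lemma isFullDim_inter_of_mem {ℓ ℓ' : ℕ} (S : DecoratedOSP n k ℓ) (T : DecoratedOSP n k ℓ')
    (hn : 0 < n) {p : Fin ℓ} {q : Fin ℓ'} {z : Fin n → ℝ} (hz : z ∈ openHypersimplex k n)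
    (hp : z ∈ S.strictPlate p) (hq : z ∈ T.strictPlate q) :
    IsFullDim ((S.plate p ∩ hypersimplex k n) ∩ (T.plate q ∩ hypersimplex k n)) := by
  refine isFullDim_of_isOpen hn (c := k) (fun x hx => hx.1.2.2)
    (((S.isOpen_strictPlate p).inter (T.isOpen_strictPlate q)).inter (isOpen_openCube n))
    ⟨⟨hp, hq⟩, hz.1⟩ hz.2 ?_
  rintro x ⟨⟨h1, h2⟩, h3⟩ hx
  have hΔ : x ∈ hypersimplex k n := openHypersimplex_subset k n ⟨h3, hx⟩
  exact ⟨⟨S.strictPlate_subset_plate p hx h1, hΔ⟩, T.strictPlate_subset_plate q hx h2, hΔ⟩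

lemma exists_mem_commonRefinement (σ : Equiv.Perm (Fin n)) (hk : 1 ≤ k) (hkn : k < n)
    {J₁ J₂ : Finset (Fin n)} (hJ₁ : J₁.card = k) (hJ₂ : J₂.card = k) {x : Fin n → ℝ}
    (hx : x ∈ hypersimplex k n) :
    ∃ R ∈ commonRefinement (ofSet σ J₁ hJ₁).cells (ofSet σ J₂ hJ₂).cells, x ∈ R := by
  let i : Fin n := ⟨0, by omega⟩
  obtain ⟨y, hy, hgen⟩ := exists_generic σ i hk hkn hJ₁ hJ₂
  obtain ⟨p, hp, hp'⟩ := (ofSet σ J₁ hJ₁).exists_mem_plate_eventually i hx.2 hy.2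
    fun r s h => (hgen r s h).1
  obtain ⟨q, hq, hq'⟩ := (ofSet σ J₂ hJ₂).exists_mem_plate_eventually i hx.2 hy.2
    fun r s h => (hgen r s h).2
  obtain ⟨t, ⟨h1, h2⟩, h3⟩ := ((hp'.and hq').and (Ioc_mem_nhdsGT (zero_lt_one' ℝ))).exists
  exact ⟨_, ⟨⟨_, ⟨p, rfl⟩, _, ⟨q, rfl⟩, rfl⟩, isFullDim_inter_of_mem _ _ (by omega)
    (openSegment_mem_openHypersimplex hx hy h3.1 h3.2) h1 h2⟩, ⟨hp, hx⟩, hq, hx⟩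

/-- Two cells of a multi-split are separated by a linear form. -/
lemma exists_separating {ℓ : ℕ} (S : DecoratedOSP n k ℓ) (p p' : Fin ℓ) :
    ∃ (l : (Fin n → ℝ) →ₗ[ℝ] ℝ) (c : ℝ), (∀ x ∈ S.plate p, l x ≤ c) ∧
      (∀ x ∈ S.plate p, x ∈ S.plate p' ↔ l x = c) := by
  obtain ⟨d, hd, rfl⟩ := exists_cyc_eq p p'
  refine ⟨-S.coordForm p d, -S.partialWeight p d, fun x hx => ?_, fun x hx => ?_⟩
  · have := (S.mem_plate_iff p hx.1).1 hx d
    rw [height_eq_coordForm] at this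
    simp only [LinearMap.neg_apply]
    linarith
  · have h0 := (S.mem_plate_iff p hx.1).1 hx
    rw [S.mem_plate_cyc_iff p d hx.1, LinearMap.neg_apply, neg_inj, ← sub_eq_zero,
      ← height_eq_coordForm]
    exact ⟨fun h => le_antisymm (by simpa using h 0) (h0 d), fun h m => h ▸ h0 m⟩

/-- Add the separating forms of the two multi-splits. As the intersection is nonempty, both maxima
are attained at one point, so the sum is maximal exactly where both summands are. -/
lemma isExposed_inter {ℓ ℓ' : ℕ} (S : DecoratedOSP n k ℓ) (T : DecoratedOSP n k ℓ')
    (p p' : Fin ℓ) (q q' : Fin ℓ') :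
    IsExposed ℝ ((S.plate p ∩ hypersimplex k n) ∩ (T.plate q ∩ hypersimplex k n))
      (((S.plate p ∩ hypersimplex k n) ∩ (T.plate q ∩ hypersimplex k n)) ∩
        ((S.plate p' ∩ hypersimplex k n) ∩ (T.plate q' ∩ hypersimplex k n))) := by
  rintro ⟨z, hz, hz'⟩
  obtain ⟨l, c, h1, h2⟩ := S.exists_separating p p'
  obtain ⟨l', c', h1', h2'⟩ := T.exists_separating q q'
  refine ⟨(l + l').toContinuousLinearMap, ?_⟩
  have hz0 : l z = c := (h2 z hz.1.1).1 hz'.1.1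
  have hz1 : l' z = c' := (h2' z hz.2.1).1 hz'.2.1
  ext x
  simp only [Set.mem_inter_iff, Set.mem_ofPred_eq, LinearMap.coe_toContinuousLinearMap',
    LinearMap.add_apply]
  constructor
  · rintro ⟨hx, hx'⟩
    refine ⟨hx, fun y hy => ?_⟩
    rw [(h2 x hx.1.1).1 hx'.1.1, (h2' x hx.2.1).1 hx'.2.1]
    exact add_le_add (h1 y hy.1.1) (h1' y hy.2.1)
  · rintro ⟨hx, h⟩
    have := h z hz
    have e1 := h1 x hx.1.1
    have e2 := h1' x hx.2.1
    refine ⟨hx, ⟨(h2 x hx.1.1).2 (by linarith), hx.1.2⟩, (h2' x hx.2.1).2 (by linarith), hx.1.2⟩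

lemma isPolytopalSubdivision (σ : Equiv.Perm (Fin n)) (hk : 1 ≤ k) (hkn : k < n)
    {J₁ J₂ : Finset (Fin n)} (hJ₁ : J₁.card = k) (hJ₂ : J₂.card = k) :
    IsPolytopalSubdivision k n
      (commonRefinement (ofSet σ J₁ hJ₁).cells (ofSet σ J₂ hJ₂).cells) where
  finite := by
    refine (Set.finite_range fun pq : Fin n × Fin n =>
      ((ofSet σ J₁ hJ₁).plate pq.1 ∩ hypersimplex k n) ∩
        ((ofSet σ J₂ hJ₂).plate pq.2 ∩ hypersimplex k n)).subset ?_
    rintro R ⟨⟨_, ⟨p, rfl⟩, _, ⟨q, rfl⟩, rfl⟩, -⟩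
    exact ⟨(p, q), rfl⟩
  polytope := by
    rintro R ⟨⟨_, ⟨p, rfl⟩, _, ⟨q, rfl⟩, rfl⟩, -⟩
    refine ⟨_, ?_, cell_eq_convexHull σ hJ₁ hJ₂ p q⟩
    refine (Set.finite_range (eVec (n := n))).subset ?_
    rintro _ ⟨B, -, rfl⟩
    exact ⟨B, rfl⟩
  fullDim := fun P hP => hP.2
  cover := by
    apply subset_antisymm
    · rintro x ⟨R, ⟨⟨_, ⟨p, rfl⟩, _, ⟨q, rfl⟩, rfl⟩, -⟩, hx⟩
      exact hx.1.2
    · intro x hx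
      obtain ⟨R, hR, hxR⟩ := exists_mem_commonRefinement σ hk hkn hJ₁ hJ₂ hx
      exact ⟨R, hR, hxR⟩
  face := by
    rintro R ⟨⟨_, ⟨p, rfl⟩, _, ⟨q, rfl⟩, rfl⟩, -⟩ R' ⟨⟨_, ⟨p', rfl⟩, _, ⟨q', rfl⟩, rfl⟩, -⟩
    exact isExposed_inter _ _ p p' q q'

end DecoratedOSP

/-! ### Basis exchange for lattice paths under weak separation -/

lemma exists_lt_succ_of_lt {Z : ℕ → ℤ} {a b : ℕ} (hab : a ≤ b) (h : Z a < Z b) :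
    ∃ j, a ≤ j ∧ j < b ∧ Z j < Z (j + 1) := by
  by_contra! hc
  have : ∀ m, a ≤ m → m ≤ b → Z m ≤ Z a := by
    intro m hm
    induction m, hm using Nat.le_induction with
    | base => simp
    | succ m hm ih => exact fun hmb => (hc m hm hmb).trans (ih (by omega))
  exact absurd (this b hab le_rfl) h.not_ge

/-- A fall at `i` without a net loss must be compensated by a rise. Applied to `Z = Y - X`, the rise
is at an element of the second basis that is not in the first. -/
lemma exists_lt_succ_of_le {Z : ℕ → ℤ} {a b i : ℕ} (hai : a ≤ i) (hib : i < b)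
    (hi : Z (i + 1) < Z i) (h : Z a ≤ Z b) : ∃ j, a ≤ j ∧ j < b ∧ Z j < Z (j + 1) := by
  rcases lt_or_ge (Z a) (Z i) with h1 | h1
  · obtain ⟨j, h2, h3, h4⟩ := exists_lt_succ_of_lt hai h1
    exact ⟨j, h2, by omega, h4⟩
  · obtain ⟨j, h2, h3, h4⟩ := exists_lt_succ_of_lt (Z := Z) (a := i + 1) (b := b) (by omega)
      (by omega)
    exact ⟨j, by omega, h3, h4⟩

/-- The first index after `i`, up to `b`, at which a condition that holds at `b` is met. -/
lemma exists_first_after {P : ℕ → Prop} {i b : ℕ} (hib : i < b) (hb : P b) :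
    ∃ r, i < r ∧ r ≤ b ∧ P r ∧ ∀ m, i < m → m < r → ¬ P m := by
  classical
  have h : ∃ r, i < r ∧ P r := ⟨b, hib, hb⟩
  exact ⟨Nat.find h, (Nat.find_spec h).1, Nat.find_min' h ⟨hib, hb⟩, (Nat.find_spec h).2,
    fun m h1 h2 h3 => Nat.find_min h h2 ⟨h1, h3⟩⟩

/-- Basis exchange for lattice paths `X`, `Y` satisfying the inequalities of two cyclically shifted
Schubert matroids with separated paths `C₁`, `C₂`. -/
lemma exists_exchange_step {n d i : ℕ} (hd : d < n) (hi : i < n) {X Y C₁ C₂ : ℕ → ℤ}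
    (hX0 : X 0 = 0) (hY0 : Y 0 = 0) (h20 : C₂ 0 = 0)
    (h1n : C₁ n = X n) (h2n : C₂ n = X n)
    (hX1 : ∀ m ≤ n, C₁ m ≤ X m) (hX2 : ∀ m ≤ n, X d - C₂ d ≤ X m - C₂ m)
    (hY1 : ∀ m ≤ n, C₁ m ≤ Y m) (hY2 : ∀ m ≤ n, Y d - C₂ d ≤ Y m - C₂ m)
    (hXY : Y (i + 1) - X (i + 1) < Y i - X i)
    (hsep : ∀ w₁ w₂ w₃, w₁ ≤ w₂ → w₂ ≤ w₃ → w₃ ≤ n → ¬ (C₁ w₁ < C₂ w₁ ∧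
      C₁ w₁ - C₂ w₁ < C₁ w₂ - C₂ w₂ ∧ C₁ w₃ - C₂ w₃ < C₁ w₂ - C₂ w₂ ∧ C₁ w₃ < C₂ w₃)) :
    ∃ j < n, Y j - X j < Y (j + 1) - X (j + 1) ∧
      (∀ m ≤ n, C₁ m ≤ X m - (if i < m then 1 else 0) + (if j < m then 1 else 0)) ∧
      (∀ m ≤ n, X d - (if i < d then 1 else 0) + (if j < d then 1 else 0) - C₂ d ≤
        X m - (if i < m then 1 else 0) + (if j < m then 1 else 0) - C₂ m) := by
  -- Exchanging `i` for `j > i` lowers `X` by one on `(i, j]`, so `j` must stay before the first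
  -- tight index after `i`. Here `r₁` is that index for `C₁`; below, `r₂` plays this role for `C₂`.
  obtain ⟨r₁, hir₁, hr₁n, ht₁, hf₁⟩ :=
    exists_first_after (P := fun r => X r = C₁ r) hi h1n.symm
  have val₁ : ∀ j < r₁, ∀ m ≤ n,
      C₁ m ≤ X m - (if i < m then 1 else 0) + (if j < m then 1 else 0) := by
    intro j hj m hm
    have h0 := hX1 m hm
    by_cases hc : i < m ∧ m ≤ j
    · have := hf₁ m hc.1 (by omega)
      rw [if_pos hc.1, if_neg (by omega)]
      omega
    · split_ifs <;> omega
  have z₁ := hY1 r₁ hr₁n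
  have zd := hY2 0 (by omega)
  have xd := hX2 0 (by omega)
  have x1d := hX1 d hd.le
  have y1d := hY1 d hd.le
  rcases lt_or_ge i d with hid | hid
  · obtain ⟨r₂, hir₂, hr₂d, ht₂, hf₂⟩ :=
      exists_first_after (P := fun r => X r - C₂ r = X d - C₂ d) hid rfl
    -- For `j ≥ d` the reference value at `d` drops by one as well, so the second constraint cannot
    -- fail.
    have val₂ : ∀ j, j < r₂ ∨ d ≤ j → ∀ m ≤ n,
        X d - (if i < d then 1 else 0) + (if j < d then 1 else 0) - C₂ d ≤
          X m - (if i < m then 1 else 0) + (if j < m then 1 else 0) - C₂ m := by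
      intro j hj m hm
      have h0 := hX2 m hm
      rw [if_pos hid]
      by_cases hjd : d ≤ j
      · rw [if_neg (by omega : ¬ j < d)]
        split_ifs <;> omega
      · rw [if_pos (by omega : j < d)]
        by_cases hc : i < m ∧ m ≤ j
        · have := hf₂ m hc.1 (by omega)
          rw [if_pos hc.1, if_neg (by omega)]
          omega
        · split_ifs <;> omega
    have z₂ := hY2 r₂ (by omega)
    suffices h : ∃ j < r₁, (j < r₂ ∨ d ≤ j) ∧ Y j - X j < Y (j + 1) - X (j + 1) by
      obtain ⟨j, h1, h2, h3⟩ := h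
      exact ⟨j, by omega, h3, val₁ j h1, val₂ j h2⟩
    rcases le_or_gt r₁ r₂ with h12 | h12
    · obtain ⟨j, -, h2, h3⟩ := exists_lt_succ_of_le (Z := fun m => Y m - X m) (Nat.zero_le i)
        hir₁ hXY (by omega)
      exact ⟨j, h2, Or.inl (by omega), h3⟩
    · have hz : 0 ≤ Y r₂ - X r₂ ∨ d < r₁ := by
        by_contra! hc
        have s1 := hX1 r₂ (by omega)
        have s2 := hf₁ r₂ hir₂ h12
        have s3 := hX2 r₁ hr₁n
        exact hsep r₂ r₁ d h12.le hc.2 hd.le (by omega)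
      by_cases hz0 : 0 ≤ Y r₂ - X r₂
      · obtain ⟨j, -, h2, h3⟩ := exists_lt_succ_of_le (Z := fun m => Y m - X m) (Nat.zero_le i)
          hir₂ hXY (by omega)
        exact ⟨j, by omega, Or.inl (by omega), h3⟩
      · have hdr := hz.resolve_left hz0
        obtain ⟨j, h1, h2, h3⟩ := exists_lt_succ_of_lt (Z := fun m => Y m - X m) hdr.le
          (by omega)
        exact ⟨j, h2, Or.inr h1, h3⟩
  · by_cases hex : ∃ r, i < r ∧ r ≤ n ∧ X r - C₂ r = X d - C₂ d
    · obtain ⟨b, hib, hbn, hb⟩ := hex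
      obtain ⟨r₂, hir₂, hr₂b, ht₂, hf₂⟩ :=
        exists_first_after (P := fun r => X r - C₂ r = X d - C₂ d) hib hb
      have val₂ : ∀ j, d ≤ j → j < r₂ → ∀ m ≤ n,
          X d - (if i < d then 1 else 0) + (if j < d then 1 else 0) - C₂ d ≤
            X m - (if i < m then 1 else 0) + (if j < m then 1 else 0) - C₂ m := by
        intro j hdj hj m hm
        have h0 := hX2 m hm
        rw [if_neg (by omega : ¬ i < d), if_neg (by omega : ¬ j < d)]
        by_cases hc : i < m ∧ m ≤ j
        · have := hf₂ m hc.1 (by omega)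
          rw [if_pos hc.1, if_neg (by omega)]
          omega
        · split_ifs <;> omega
      have z₂ := hY2 r₂ (by omega)
      suffices h : ∃ r ≤ r₁, r ≤ r₂ ∧ i < r ∧ Y d - X d ≤ Y r - X r by
        obtain ⟨r, h1, h2, h3, h4⟩ := h
        obtain ⟨j, h5, h6, h7⟩ := exists_lt_succ_of_le (Z := fun m => Y m - X m) hid h3 hXY h4
        exact ⟨j, by omega, h7, val₁ j (by omega), val₂ j h5 (by omega)⟩
      rcases le_or_gt r₂ r₁ with h12 | h12
      · exact ⟨r₂, h12, le_rfl, hir₂, by omega⟩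
      · refine ⟨r₁, le_rfl, h12.le, hir₁, ?_⟩
        -- Otherwise `d`, `r₁`, `r₂` form a forbidden low-high-low pattern of `C₁ - C₂`.
        by_contra! hc
        have s1 := hX2 r₁ hr₁n
        have s2 := hf₂ r₁ hir₁ h12
        have s3 := hX1 r₂ (by omega)
        exact hsep d r₁ r₂ (by omega) h12.le (by omega) (by omega)
    · push Not at hex
      have hn := hX2 n le_rfl
      have hn' := hex n hi le_rfl
      have hd0 : 0 < d := by
        rcases Nat.eq_zero_or_pos d with h | h
        · rw [h] at hn'; omega
        · exact h
      -- With no tight index between `i` and `n`, the search for one continues cyclically from `0`;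
      -- it ends at `d` at the latest.
      obtain ⟨r₂, hr₂0, hr₂d, ht₂, hf₂⟩ :=
        exists_first_after (P := fun r => X r - C₂ r = X d - C₂ d) hd0 rfl
      have val₂ : ∀ j, j < r₂ ∨ d ≤ j → ∀ m ≤ n,
          X d - (if i < d then 1 else 0) + (if j < d then 1 else 0) - C₂ d ≤
            X m - (if i < m then 1 else 0) + (if j < m then 1 else 0) - C₂ m := by
        intro j hj m hm
        have h0 := hX2 m hm
        rw [if_neg (by omega : ¬ i < d)]
        have h1 : i < m → X d - C₂ d < X m - C₂ m := fun him => h0.lt_of_ne' (hex m him hm)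
        by_cases hjd : d ≤ j
        · rw [if_neg (by omega : ¬ j < d)]
          split_ifs <;> omega
        · rw [if_pos (by omega : j < d)]
          have h2 : m ≤ j → X d - C₂ d < X m - C₂ m := by
            intro hmj
            rcases Nat.eq_zero_or_pos m with rfl | hm0
            · omega
            · exact h0.lt_of_ne' (hf₂ m hm0 (by omega))
          split_ifs <;> omega
      have z₂ := hY2 r₂ (by omega)
      suffices h : ∃ j < r₁, (j < r₂ ∨ d ≤ j) ∧ Y j - X j < Y (j + 1) - X (j + 1) by
        obtain ⟨j, h1, h2, h3⟩ := h
        exact ⟨j, by omega, h3, val₁ j h1, val₂ j h2⟩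
      by_cases hz : Y d - X d ≤ Y r₁ - X r₁
      · obtain ⟨j, h1, h2, h3⟩ := exists_lt_succ_of_le (Z := fun m => Y m - X m) hid hir₁ hXY hz
        exact ⟨j, h2, Or.inr h1, h3⟩
      · obtain ⟨j, h1, h2, h3⟩ := exists_lt_succ_of_lt (Z := fun m => Y m - X m)
          (Nat.zero_le r₂) (by omega)
        exact ⟨j, by omega, Or.inl h2, h3⟩

namespace DecoratedOSP

variable {n k : ℕ}

lemma val_cyc (p : Fin n) {t : ℕ} (ht : t < n) :
    (cyc p t : ℕ) = if (p : ℕ) + t < n then (p : ℕ) + t else p + t - n := by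
  have hp := p.2
  simp only [cyc]
  split_ifs with h
  · exact Nat.mod_eq_of_lt h
  · rw [Nat.mod_eq_sub_mod (by omega), Nat.mod_eq_of_lt (by omega)]

lemma cyclicallyOrdered_cyc (σ : Equiv.Perm (Fin n)) (p : Fin n) {t₁ t₂ t₃ t₄ : ℕ}
    (h12 : t₁ < t₂) (h23 : t₂ < t₃) (h34 : t₃ < t₄) (h4 : t₄ < n) :
    CyclicallyOrdered σ (σ (cyc p t₁)) (σ (cyc p t₂)) (σ (cyc p t₃)) (σ (cyc p t₄)) := by
  have hp := p.2
  simp only [CyclicallyOrdered, Equiv.symm_apply_apply, Fin.lt_def,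
    val_cyc p (by omega : t₁ < n), val_cyc p (by omega : t₂ < n), val_cyc p (by omega : t₃ < n),
    val_cyc p h4]
  split_ifs <;> omega

lemma _root_.CyclicallyOrdered.rotate {σ : Equiv.Perm (Fin n)} {a b c d : Fin n}
    (h : CyclicallyOrdered σ a b c d) : CyclicallyOrdered σ b c d a := by
  unfold CyclicallyOrdered at *
  tauto

/-- A descent of the difference of the counting functions yields an element of `B \ A`. -/
lemma exists_mem_sdiff_of_count_lt (σ : Equiv.Perm (Fin n)) (p : Fin n) (A B : Finset (Fin n))
    {u v : ℕ} (huv : u ≤ v) (h : count σ p A v - count σ p B v < count σ p A u - count σ p B u) :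
    ∃ t, u ≤ t ∧ t < v ∧ σ (cyc p t) ∈ B \ A := by
  obtain ⟨t, h1, h2, h3⟩ := exists_lt_succ_of_lt
    (Z := fun m => count σ p B m - count σ p A m) huv (by omega)
  refine ⟨t, h1, h2, ?_⟩
  simp only [count_succ] at h3
  rw [Finset.mem_sdiff]
  by_cases hB : σ (cyc p t) ∈ B <;> by_cases hA : σ (cyc p t) ∈ A <;> simp_all

/-- The difference of the counts is `0` at both ends, so the pattern would force a fall, a rise, a
fall and a rise. Falls come from `J₂ \ J₁` and rises from `J₁ \ J₂`, which gives four alternating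
elements. -/
lemma separated_of_weaklySeparated {σ : Equiv.Perm (Fin n)} {J₁ J₂ : Finset (Fin n)}
    (hJ₁ : J₁.card = k) (hJ₂ : J₂.card = k) (h : WeaklySeparated σ J₁ J₂) (p : Fin n)
    (w₁ w₂ w₃ : ℕ) (h12 : w₁ ≤ w₂) (h23 : w₂ ≤ w₃) (h3 : w₃ ≤ n) :
    ¬ (count σ p J₁ w₁ < count σ p J₂ w₁ ∧
      count σ p J₁ w₁ - count σ p J₂ w₁ < count σ p J₁ w₂ - count σ p J₂ w₂ ∧
      count σ p J₁ w₃ - count σ p J₂ w₃ < count σ p J₁ w₂ - count σ p J₂ w₂ ∧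
      count σ p J₁ w₃ < count σ p J₂ w₃) := by
  rintro ⟨e1, e2, e3, e4⟩
  have hn : count σ p J₁ n = count σ p J₂ n := by rw [count_period, count_period, hJ₁, hJ₂]
  obtain ⟨t₁, -, b1, m1⟩ := exists_mem_sdiff_of_count_lt σ p J₁ J₂ (Nat.zero_le w₁)
    (by simp only [count_zero]; omega)
  obtain ⟨t₂, a2, b2, m2⟩ := exists_mem_sdiff_of_count_lt σ p J₂ J₁ h12 (by omega)
  obtain ⟨t₃, a3, b3, m3⟩ := exists_mem_sdiff_of_count_lt σ p J₁ J₂ h23 (by omega)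
  obtain ⟨t₄, a4, b4, m4⟩ := exists_mem_sdiff_of_count_lt σ p J₂ J₁ h3 (by omega)
  have hord : CyclicallyOrdered σ (σ (cyc p t₁)) (σ (cyc p t₂)) (σ (cyc p t₃)) (σ (cyc p t₄)) :=
    cyclicallyOrdered_cyc σ p (by omega) (by omega) (by omega) b4
  exact h ⟨_, _, _, _, m2, m4, m3, m1, hord.rotate⟩

lemma count_insert_erase (σ : Equiv.Perm (Fin n)) (p : Fin n) {B : Finset (Fin n)} {i j : ℕ}
    (hi : i < n) (hj : j < n) (hiB : σ (cyc p i) ∈ B) (hjB : σ (cyc p j) ∉ B) {m : ℕ}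
    (hm : m ≤ n) : count σ p (insert (σ (cyc p j)) (B.erase (σ (cyc p i)))) m =
      count σ p B m - (if i < m then 1 else 0) + (if j < m then 1 else 0) := by
  induction m with
  | zero => simp
  | succ m ih =>
    rw [count_succ, count_succ, ih (by omega)]
    have e : ∀ t < n, (σ (cyc p m) = σ (cyc p t) ↔ m = t) := fun t ht =>
      ⟨fun h => cyc_injOn p hm ht (σ.injective h), fun h => h ▸ rfl⟩
    simp only [Finset.mem_insert, Finset.mem_erase, ne_eq, e i hi, e j hj]
    have hij : i ≠ j := fun h => hjB (h ▸ hiB)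
    rcases eq_or_ne m i with rfl | hmi
    · simp only [hiB, hij, if_true, not_true, false_and, or_self, if_false]
      split_ifs <;> omega
    · rcases eq_or_ne m j with rfl | hmj
      · simp only [hjB, if_true, true_or, if_false]
        split_ifs <;> omega
      · simp only [hmi, hmj, not_false_eq_true, true_and, false_or]
        have e1 : i < m + 1 ↔ i < m := by omega
        have e2 : j < m + 1 ↔ j < m := by omega
        simp only [e1, e2]
        ring

lemma exists_eq_cyc (σ : Equiv.Perm (Fin n)) (p a : Fin n) : ∃ t < n, σ (cyc p t) = a := by
  obtain ⟨t, ht, h⟩ := exists_cyc_eq p (σ.symm a)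
  exact ⟨t, ht, by simp [h]⟩

lemma exists_exchange {σ : Equiv.Perm (Fin n)} {J₁ J₂ : Finset (Fin n)}
    (hJ₁ : J₁.card = k) (hJ₂ : J₂.card = k) (h : WeaklySeparated σ J₁ J₂) (p q : Fin n)
    {B B' : Finset (Fin n)} (hB : B.card = k) (hB' : B'.card = k)
    (hp : eVec B ∈ (ofSet σ J₁ hJ₁).plate p) (hq : eVec B ∈ (ofSet σ J₂ hJ₂).plate q)
    (hp' : eVec B' ∈ (ofSet σ J₁ hJ₁).plate p) (hq' : eVec B' ∈ (ofSet σ J₂ hJ₂).plate q)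
    {e : Fin n} (he : e ∈ B) (he' : e ∉ B') :
    ∃ f ∈ B', f ∉ B ∧ (insert f (B.erase e)).card = k ∧
      eVec (insert f (B.erase e)) ∈ (ofSet σ J₁ hJ₁).plate p ∧
      eVec (insert f (B.erase e)) ∈ (ofSet σ J₂ hJ₂).plate q := by
  obtain ⟨d, hd, rfl⟩ := exists_cyc_eq p q
  obtain ⟨i, hi, rfl⟩ := exists_eq_cyc σ p e
  rw [← cyc_zero p] at hp hp'
  rw [eVec_mem_plate_iff _ _ _ _ _ hB] at hp hq
  rw [eVec_mem_plate_iff _ _ _ _ _ hB'] at hp' hq'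
  simp only [count_zero, sub_zero, sub_nonneg] at hp hp'
  have per : ∀ A : Finset (Fin n), A.card = k → count σ p A n = k := fun A hA => by
    rw [count_period, hA]
  -- Plate membership only speaks of `m < n`, whereas the path lemma also uses the endpoint `n`,
  -- where all counts equal `k`.
  have ext : ∀ {P : ℕ → Prop}, (∀ m < n, P m) → P n → ∀ m ≤ n, P m := fun h hn m hm =>
    hm.lt_or_eq.elim (h m) (fun e => e ▸ hn)
  have k0 := hq 0 (by omega)
  have k0' := hq' 0 (by omega)
  simp only [count_zero] at k0 k0'
  obtain ⟨j, hj, hjs, v1, v2⟩ := exists_exchange_step hd hi (X := count σ p B)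
    (Y := count σ p B') (C₁ := count σ p J₁) (C₂ := count σ p J₂) (count_zero _ _ _)
    (count_zero _ _ _) (count_zero _ _ _)
    (by rw [per _ hB, per _ hJ₁]) (by rw [per _ hB, per _ hJ₂])
    (ext hp (by rw [per _ hB, per _ hJ₁])) (ext hq (by rw [per _ hB, per _ hJ₂]; omega))
    (ext hp' (by rw [per _ hB', per _ hJ₁])) (ext hq' (by rw [per _ hB', per _ hJ₂]; omega))
    (by rw [count_succ, count_succ, if_pos he, if_neg he']; omega)
    (separated_of_weaklySeparated hJ₁ hJ₂ h p)
  rw [count_succ, count_succ] at hjs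
  have hjB : σ (cyc p j) ∉ B := fun hc => by
    rw [if_pos hc] at hjs
    split_ifs at hjs <;> omega
  have hjB' : σ (cyc p j) ∈ B' := by
    by_contra hc
    rw [if_neg hc, if_neg hjB] at hjs
    omega
  have hcard : (insert (σ (cyc p j)) (B.erase (σ (cyc p i)))).card = k := by
    rw [Finset.card_insert_of_notMem (fun hc => hjB (Finset.mem_of_mem_erase hc)),
      Finset.card_erase_of_mem he, hB]
    have := Finset.card_pos.2 ⟨_, he⟩
    omega
  refine ⟨_, hjB', hjB, hcard, ?_, ?_⟩
  · have : eVec (insert (σ (cyc p j)) (B.erase (σ (cyc p i)))) ∈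
        (ofSet σ J₁ hJ₁).plate (cyc p 0) := by
      rw [eVec_mem_plate_iff _ _ _ _ _ hcard]
      intro m hm
      rw [count_insert_erase σ p hi hj he hjB hm.le]
      simpa using v1 m hm.le
    rwa [cyc_zero] at this
  · rw [eVec_mem_plate_iff _ _ _ _ _ hcard]
    intro m hm
    rw [count_insert_erase σ p hi hj he hjB hm.le, count_insert_erase σ p hi hj he hjB hd.le]
    exact v2 m hm.le

lemma isMatroidPolytope_of_weaklySeparated {σ : Equiv.Perm (Fin n)} {J₁ J₂ : Finset (Fin n)}
    (hJ₁ : J₁.card = k) (hJ₂ : J₂.card = k) (h : WeaklySeparated σ J₁ J₂) (p q : Fin n)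
    (hne : (((ofSet σ J₁ hJ₁).plate p ∩ hypersimplex k n) ∩
      ((ofSet σ J₂ hJ₂).plate q ∩ hypersimplex k n)).Nonempty) :
    IsMatroidPolytope (((ofSet σ J₁ hJ₁).plate p ∩ hypersimplex k n) ∩
      ((ofSet σ J₂ hJ₂).plate q ∩ hypersimplex k n)) := by
  rw [cell_eq_convexHull] at hne ⊢
  refine ⟨Matroid.ofIsBaseOfFinite Set.finite_univ (fun s => ∃ B : Finset (Fin n), s = ↑B ∧
    B.card = k ∧ eVec B ∈ (ofSet σ J₁ hJ₁).plate p ∧ eVec B ∈ (ofSet σ J₂ hJ₂).plate q)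
    ?_ ?_ (fun _ _ => Set.subset_univ _), rfl, ?_⟩
  · obtain ⟨_, B, hB, -⟩ := convexHull_nonempty_iff.1 hne
    exact ⟨↑B, B, rfl, hB⟩
  · rintro _ _ ⟨B, rfl, hB, hp, hq⟩ ⟨B', rfl, hB', hp', hq'⟩ e ⟨he, he'⟩
    obtain ⟨f, hf, hf', hh⟩ := exists_exchange hJ₁ hJ₂ h p q hB hB' hp hq hp' hq'
      (Finset.mem_coe.1 he) (fun hc => he' (Finset.mem_coe.2 hc))
    exact ⟨f, ⟨hf, hf'⟩, _, by simp, hh⟩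
  · congr 1
    ext x
    simp only [Set.mem_ofPred_eq]
    constructor
    · rintro ⟨B, hB, rfl⟩
      exact ⟨B, ⟨B, rfl, hB⟩, rfl⟩
    · rintro ⟨B, ⟨B', e, hB⟩, rfl⟩
      obtain rfl := Finset.coe_injective e
      exact ⟨B, hB, rfl⟩

end DecoratedOSP

/-! ### Failure of symmetric exchange without weak separation -/

/-- Symmetric basis exchange. -/
lemma Matroid.IsBase.exists_symmetric_exchange {α : Type*} {M : Matroid α} {B₁ B₂ : Set α}
    (h₁ : M.IsBase B₁) (h₂ : M.IsBase B₂) {e : α} (he : e ∈ B₁ \ B₂) :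
    ∃ f ∈ B₂ \ B₁, M.IsBase (insert f B₁ \ {e}) ∧ M.IsBase (insert e B₂ \ {f}) := by
  have heE := h₁.subset_ground he.1
  -- A circuit and a cocircuit never meet in exactly one element. The fundamental circuit of `e`
  -- over `B₂` and its fundamental cocircuit for `B₁` share `e`, hence also some other `f`.
  obtain ⟨f, ⟨hfC, hfK⟩, hfe⟩ := ((h₂.fundCircuit_isCircuit heE he.2).isCocircuit_inter_nontrivial
    (M.fundCocircuit_isCocircuit he.1 h₁)
    ⟨e, M.mem_fundCircuit e B₂, M.mem_fundCocircuit e B₁⟩).exists_ne e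
  have hf₂ : f ∈ B₂ := (M.fundCircuit_subset_insert e B₂ hfC).resolve_left hfe
  have hf₁ : f ∈ M.E \ B₁ := (M.fundCocircuit_subset_insert_compl e B₁ hfK).resolve_left hfe
  rw [h₁.mem_fundCocircuit_iff_mem_fundCircuit,
    h₁.indep.mem_fundCircuit_iff (by rw [h₁.closure_eq]; exact hf₁.1) hf₁.2] at hfK
  rw [h₂.indep.mem_fundCircuit_iff (by rwa [h₂.closure_eq]) he.2] at hfC
  exact ⟨f, ⟨hf₂, hf₁.2⟩, h₁.exchange_isBase_of_indep' he.1 hf₁.2 hfK,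
    h₂.exchange_isBase_of_indep' hf₂ he.2 hfC⟩

/-- A vertex of the cube that lies in the convex hull of vertices is one of them. -/
lemma of_eVec_mem_convexHull {n : ℕ} {F : Finset (Fin n) → Prop} {A : Finset (Fin n)}
    (h : eVec A ∈ convexHull ℝ {x | ∃ B : Finset (Fin n), F B ∧ x = eVec B}) : F A := by
  by_contra hA
  -- On the cube this is the ℓ¹-distance to `eVec A`: it is affine, zero at `eVec A` and at least
  -- one at every other vertex.
  let φ : (Fin n → ℝ) → ℝ := fun x => ∑ i, if i ∈ A then 1 - x i else x i
  have hconv : Convex ℝ {x | 1 ≤ φ x} := by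
    intro x hx y hy a b ha hb hab
    have : φ (a • x + b • y) = a * φ x + b * φ y := by
      simp only [φ, Finset.mul_sum, ← Finset.sum_add_distrib]
      refine Finset.sum_congr rfl fun i _ => ?_
      split_ifs
      · simp only [Pi.add_apply, Pi.smul_apply, smul_eq_mul]
        linear_combination -hab
      · simp
    have hx : 1 ≤ φ x := hx
    have hy : 1 ≤ φ y := hy
    simp only [Set.mem_ofPred_eq, this]
    nlinarith
  have hsub : {x | ∃ B : Finset (Fin n), F B ∧ x = eVec B} ⊆ {x | 1 ≤ φ x} := by
    rintro _ ⟨B, hB, rfl⟩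
    have hne : A ≠ B := fun e => hA (e ▸ hB)
    obtain ⟨i, hi⟩ : ∃ i, ¬ (i ∈ A ↔ i ∈ B) := by
      by_contra! hc
      exact hne (Finset.ext hc)
    have hnn : ∀ j ∈ Finset.univ, (0 : ℝ) ≤ if j ∈ A then 1 - eVec B j else eVec B j := by
      intro j _
      unfold eVec
      split_ifs <;> norm_num
    refine le_trans ?_ (Finset.single_le_sum hnn (Finset.mem_univ i))
    unfold eVec
    by_cases h1 : i ∈ A <;> by_cases h2 : i ∈ B <;> simp_all
  have h1 : 1 ≤ φ (eVec A) := convexHull_min hsub hconv h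
  have h0 : φ (eVec A) = 0 := Finset.sum_eq_zero fun i _ => by
    unfold eVec
    split_ifs <;> simp
  linarith

namespace DecoratedOSP

variable {n k : ℕ}

/-- Cutting the cycle at `p` breaks at most one of the disjoint arcs from `t₁` to `t₂` and from `t₃`
to `t₄`. -/
lemma exists_lt_of_cyclicallyOrdered {σ : Equiv.Perm (Fin n)} (p : Fin n) {t₁ t₂ t₃ t₄ : ℕ}
    (h1 : t₁ < n) (h2 : t₂ < n) (h3 : t₃ < n) (h4 : t₄ < n)
    (h : CyclicallyOrdered σ (σ (cyc p t₁)) (σ (cyc p t₂)) (σ (cyc p t₃)) (σ (cyc p t₄))) :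
    t₁ < t₂ ∨ t₃ < t₄ := by
  have hp := p.2
  simp only [CyclicallyOrdered, Equiv.symm_apply_apply, Fin.lt_def, val_cyc p h1, val_cyc p h2,
    val_cyc p h3, val_cyc p h4] at h
  split_ifs at h <;> omega

lemma count_succ_of_mem_sdiff {σ : Equiv.Perm (Fin n)} {p : Fin n} {A B : Finset (Fin n)} {t : ℕ}
    (h : σ (cyc p t) ∈ A \ B) :
    count σ p A (t + 1) = count σ p A t + 1 ∧ count σ p B (t + 1) = count σ p B t := by
  rw [Finset.mem_sdiff] at h
  simp [count_succ, h.1, h.2]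

/-- If `J₁`, `J₂` are not weakly separated then, seen from a suitable starting position, some level
`s ≤ 0` is passed at least four times by the difference of the counting functions. -/
lemma exists_level_of_not_weaklySeparated {σ : Equiv.Perm (Fin n)} {J₁ J₂ : Finset (Fin n)}
    (hn : 0 < n) (hJ₁ : J₁.card = k) (hJ₂ : J₂.card = k) (h : ¬ WeaklySeparated σ J₁ J₂) :
    ∃ (p : Fin n) (s : ℤ) (w₁ w₂ w₃ : ℕ), s ≤ 0 ∧ w₁ < w₂ ∧ w₂ < w₃ ∧ w₃ < n ∧
      count σ p J₁ w₁ - count σ p J₂ w₁ < s ∧ s ≤ count σ p J₁ w₂ - count σ p J₂ w₂ ∧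
      count σ p J₁ w₃ - count σ p J₂ w₃ < s := by
  have hsum : ∑ a, eVec J₂ a = (k : ℝ) := by rw [sum_eVec, hJ₂]
  -- Start where the difference of the two counts is maximal: measured from `p` it is never
  -- positive, which gives `s ≤ 0`.
  obtain ⟨p, hp⟩ := (ofSet σ J₁ hJ₁).exists_mem_plate hn hsum
  rw [mem_plate_iff _ _ hsum] at hp
  have hmax : ∀ m, count σ p J₁ m ≤ count σ p J₂ m := fun m => by
    have := hp m
    rw [height_ofSet_eVec, Int.cast_nonneg_iff] at this
    omega
  have hper : count σ p J₁ n = count σ p J₂ n := by rw [count_period, count_period, hJ₁, hJ₂]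
  obtain ⟨b, c, hbc, hc, hb', hc'⟩ : ∃ b c, b < c ∧ c < n ∧ σ (cyc p b) ∈ J₁ \ J₂ ∧
      σ (cyc p c) ∈ J₂ \ J₁ := by
    rw [WeaklySeparated, not_not] at h
    obtain ⟨i₁, i₂, j₁, j₂, hi₁, hi₂, hj₁, hj₂, hord⟩ := h
    obtain ⟨t₁, h1, rfl⟩ := exists_eq_cyc σ p i₁
    obtain ⟨t₂, h2, rfl⟩ := exists_eq_cyc σ p j₁
    obtain ⟨t₃, h3, rfl⟩ := exists_eq_cyc σ p i₂
    obtain ⟨t₄, h4, rfl⟩ := exists_eq_cyc σ p j₂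
    rcases exists_lt_of_cyclicallyOrdered p h1 h2 h3 h4 hord with h | h
    · exact ⟨t₁, t₂, h, h2, hi₁, hj₁⟩
    · exact ⟨t₃, t₄, h, h4, hi₂, hj₂⟩
  have eb := count_succ_of_mem_sdiff hb'
  have ec := count_succ_of_mem_sdiff hc'
  have m1 := hmax (b + 1)
  have m2 := hmax c
  have hcn : c + 1 ≠ n := by
    rintro e
    rw [e] at ec
    omega
  -- The level is the larger of the values just after the rise at `b` and just before the fall at
  -- `c`.
  by_cases hlev : count σ p J₁ c - count σ p J₂ c ≤ count σ p J₁ (b + 1) - count σ p J₂ (b + 1)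
  · exact ⟨p, count σ p J₁ (b + 1) - count σ p J₂ (b + 1), b, b + 1, c + 1, by omega, by omega,
      by omega, by omega, by omega, le_rfl, by omega⟩
  · exact ⟨p, count σ p J₁ c - count σ p J₂ c, b, c, c + 1, by omega, by omega,
      by omega, by omega, by omega, le_rfl, by omega⟩

lemma midpoint_mem_plate (σ : Equiv.Perm (Fin n)) {J : Finset (Fin n)} (hJ : J.card = k)
    (p : Fin n) (a : ℕ) {A B : Finset (Fin n)}
    (h : (1 / 2 : ℝ) • eVec A + (1 / 2 : ℝ) • eVec B ∈ (ofSet σ J hJ).plate (cyc p a)) (m : ℕ) :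
    count σ p A a + count σ p B a - 2 * count σ p J a ≤
      count σ p A m + count σ p B m - 2 * count σ p J m := by
  have h1 := (mem_plate_cyc_iff _ p a h.1).1 h m
  rw [height_combo _ _ _ _ _ (by norm_num), height_combo _ _ _ _ _ (by norm_num)] at h1
  simp only [height_ofSet_eVec] at h1
  push_cast at h1
  have : ((count σ p A a + count σ p B a - 2 * count σ p J a : ℤ) : ℝ) ≤
      ((count σ p A m + count σ p B m - 2 * count σ p J m : ℤ) : ℝ) := by
    push_cast
    linarith
  exact_mod_cast this

lemma coe_insert_erase {A : Finset (Fin n)} {e f : Fin n} (hf : f ≠ e) :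
    ((insert f (A.erase e) : Finset (Fin n)) : Set (Fin n)) = insert f (A : Set (Fin n)) \ {e} := by
  ext x
  simp only [Finset.coe_insert, Finset.coe_erase, Set.mem_insert_iff, Set.mem_sdiff,
    Set.mem_singleton_iff]
  by_cases hx : x = f
  · simp [hx, hf]
  · simp [hx]

lemma weaklySeparated_of_isMatroidPolytope (σ : Equiv.Perm (Fin n)) (hk : 1 ≤ k) (hkn : k < n)
    {J₁ J₂ : Finset (Fin n)} (hJ₁ : J₁.card = k) (hJ₂ : J₂.card = k)
    (hM : ∀ P ∈ commonRefinement (ofSet σ J₁ hJ₁).cells (ofSet σ J₂ hJ₂).cells,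
      IsMatroidPolytope P) : WeaklySeparated σ J₁ J₂ := by
  by_contra hws
  obtain ⟨p, s, w₁, w₂, w₃, hs, h12, h23, h3n, l1, l2, l3⟩ :=
    exists_level_of_not_weaklySeparated (by omega) hJ₁ hJ₂ hws
  have n1 : count σ p J₁ n = k := by rw [count_period, hJ₁]
  have n2 : count σ p J₂ n = k := by rw [count_period, hJ₂]
  have step : ∀ (J : Finset (Fin n)) t,
      count σ p J (t + 1) = count σ p J t ∨ count σ p J (t + 1) = count σ p J t + 1 := by
    intro J t
    rw [count_succ]
    split_ifs <;> simp
  have hG : ∀ r : ℤ, ∀ t < n,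
      max (count σ p J₁ (t + 1)) (count σ p J₂ (t + 1) + r) =
        max (count σ p J₁ t) (count σ p J₂ t + r) ∨
      max (count σ p J₁ (t + 1)) (count σ p J₂ (t + 1) + r) =
        max (count σ p J₁ t) (count σ p J₂ t + r) + 1 := by
    intro r t _
    have := step J₁ t
    have := step J₂ t
    omega
  have hGn : ∀ r : ℤ, r ≤ 0 → max (count σ p J₁ n) (count σ p J₂ n + r) =
      max (count σ p J₁ 0) (count σ p J₂ 0 + r) + k := by
    intro r hr
    rw [n1, n2, count_zero, count_zero]
    omega
  obtain ⟨B₁, hB₁, c₁⟩ : ∃ B : Finset (Fin n), B.card = k ∧ ∀ m ≤ n, count σ p B m =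
      max (count σ p J₁ m) (count σ p J₂ m + s) := by
    let G : ℕ → ℤ := fun m => max (count σ p J₁ m) (count σ p J₂ m + s)
    refine ⟨_, card_ofCount σ p (G := G) (hG s) (hGn s hs), fun m hm => ?_⟩
    rw [count_ofCount σ p (G := G) (hG s) hm]
    simp only [G, count_zero]
    omega
  obtain ⟨B₂, hB₂, c₂⟩ : ∃ B : Finset (Fin n), B.card = k ∧ ∀ m ≤ n, count σ p B m =
      max (count σ p J₁ m) (count σ p J₂ m + (s - 1)) := by
    let G : ℕ → ℤ := fun m => max (count σ p J₁ m) (count σ p J₂ m + (s - 1))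
    refine ⟨_, card_ofCount σ p (G := G) (hG (s - 1)) (hGn (s - 1) (by omega)), fun m hm => ?_⟩
    rw [count_ofCount σ p (G := G) (hG (s - 1)) hm]
    simp only [G, count_zero]
    omega
  -- A cell containing the midpoint of `B₁` and `B₂` is shown below to contain both. The midpoint
  -- inequalities at `0` and at `w₁` place `a` where the difference is at least `s` and `b` where it
  -- is below `s`.
  obtain ⟨R, hR, hu⟩ := exists_mem_commonRefinement σ hk hkn hJ₁ hJ₂
    (convex_hypersimplex k n (eVec_mem_hypersimplex hB₁) (eVec_mem_hypersimplex hB₂)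
      (by norm_num : (0 : ℝ) ≤ 1 / 2) (by norm_num : (0 : ℝ) ≤ 1 / 2) (by norm_num))
  obtain ⟨M, -, hRM⟩ := hM R hR
  obtain ⟨⟨_, ⟨p', rfl⟩, _, ⟨q', rfl⟩, rfl⟩, -⟩ := hR
  obtain ⟨a, ha, rfl⟩ := exists_cyc_eq p p'
  obtain ⟨b, hb, rfl⟩ := exists_cyc_eq p q'
  have ca₁ := c₁ a ha.le
  have ca₂ := c₂ a ha.le
  have cb₁ := c₁ b hb.le
  have cb₂ := c₂ b hb.le
  have hahi : s ≤ count σ p J₁ a - count σ p J₂ a := by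
    have h := midpoint_mem_plate σ hJ₁ p a hu.1.1 0
    simp only [count_zero] at h
    omega
  have hblo : count σ p J₁ b - count σ p J₂ b < s := by
    have h := midpoint_mem_plate σ hJ₂ p b hu.2.1 w₁
    rw [c₁ w₁ (by omega), c₂ w₁ (by omega)] at h
    omega
  have base : ∀ {B : Finset (Fin n)}, B.card = k →
      (M.IsBase B ↔ eVec B ∈ (ofSet σ J₁ hJ₁).plate (cyc p a) ∧
        eVec B ∈ (ofSet σ J₂ hJ₂).plate (cyc p b)) := by
    intro B hB
    constructor
    · intro h
      have : eVec B ∈ convexHull ℝ {x | ∃ B : Finset (Fin n), M.IsBase (B : Set (Fin n)) ∧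
          x = eVec B} := subset_convexHull ℝ _ ⟨B, h, rfl⟩
      rw [← hRM] at this
      exact ⟨this.1.1, this.2.1⟩
    · rintro ⟨h1, h2⟩
      refine of_eVec_mem_convexHull (F := fun B : Finset (Fin n) => M.IsBase (B : Set (Fin n))) ?_
      rw [← hRM]
      exact ⟨⟨h1, eVec_mem_hypersimplex hB⟩, h2, eVec_mem_hypersimplex hB⟩
  have base₁ : M.IsBase B₁ := by
    rw [base hB₁, eVec_mem_plate_iff _ _ _ _ _ hB₁, eVec_mem_plate_iff _ _ _ _ _ hB₁]
    refine ⟨fun m hm => ?_, fun m hm => ?_⟩ <;>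
    · have := c₁ m hm.le
      omega
  have base₂ : M.IsBase B₂ := by
    rw [base hB₂, eVec_mem_plate_iff _ _ _ _ _ hB₂, eVec_mem_plate_iff _ _ _ _ _ hB₂]
    refine ⟨fun m hm => ?_, fun m hm => ?_⟩ <;>
    · have := c₂ m hm.le
      omega
  obtain ⟨e, he⟩ : (B₁ \ B₂).Nonempty := by
    rw [Finset.sdiff_nonempty]
    intro hsub
    have heq := Finset.eq_of_subset_of_card_le hsub (by omega)
    have e1 := c₁ w₁ (by omega)
    have e2 := c₂ w₁ (by omega)
    rw [heq] at e1
    omega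
  rw [Finset.mem_sdiff] at he
  obtain ⟨f, hf, b₃, b₄⟩ := base₁.exists_symmetric_exchange base₂ (e := e) (by simpa using he)
  have hf₂ : f ∈ B₂ := by simpa using hf.1
  have hf₁ : f ∉ B₁ := by simpa using hf.2
  have hfe : f ≠ e := fun h => hf₁ (h ▸ he.1)
  rw [← coe_insert_erase hfe] at b₃
  rw [← coe_insert_erase hfe.symm] at b₄
  have hcard : ∀ {A : Finset (Fin n)} {x y : Fin n}, A.card = k → x ∈ A → y ∉ A →
      (insert y (A.erase x)).card = k := by
    intro A x y hA hx hy
    rw [Finset.card_insert_of_notMem (fun hc => hy (Finset.mem_of_mem_erase hc)),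
      Finset.card_erase_of_mem hx, hA]
    omega
  have hc₃ := hcard hB₁ he.1 hf₁
  have hc₄ := hcard hB₂ hf₂ he.2
  rw [base hc₃, eVec_mem_plate_iff _ _ _ _ _ hc₃, eVec_mem_plate_iff _ _ _ _ _ hc₃] at b₃
  rw [base hc₄, eVec_mem_plate_iff _ _ _ _ _ hc₄, eVec_mem_plate_iff _ _ _ _ _ hc₄] at b₄
  obtain ⟨i, hi, rfl⟩ := exists_eq_cyc σ p e
  obtain ⟨j, hj, rfl⟩ := exists_eq_cyc σ p f
  have hij : i ≠ j := fun h => hfe (h ▸ rfl)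
  -- The exchange changes the path of `B₁` by `g` and that of `B₂` by `-g`.
  let g : ℕ → ℤ := fun m => -(if i < m then 1 else 0) + (if j < m then 1 else 0)
  have d₃ : ∀ m ≤ n, count σ p (insert (σ (cyc p j)) (B₁.erase (σ (cyc p i)))) m =
      max (count σ p J₁ m) (count σ p J₂ m + s) + g m := fun m hm => by
    rw [count_insert_erase σ p hi hj he.1 hf₁ hm, c₁ m hm]
    simp only [g]
    ring
  have d₄ : ∀ m ≤ n, count σ p (insert (σ (cyc p i)) (B₂.erase (σ (cyc p j)))) m =
      max (count σ p J₁ m) (count σ p J₂ m + (s - 1)) - g m := fun m hm => by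
    rw [count_insert_erase σ p hj hi hf₂ he.2 hm, c₂ m hm]
    simp only [g]
    ring
  have g0 : g 0 = 0 := by simp [g]
  have gn : g n = 0 := by simp [g, hi, hj]
  -- Here both paths equal that of `J₁`, so both are tight. The two exchanged sets then bound `g m -
  -- g a` from either side. `glo` is the same argument with `J₂`.
  have ghi : ∀ m < n, s ≤ count σ p J₁ m - count σ p J₂ m → g m = g a := by
    intro m hm hsm
    have e3 := b₃.1 m hm
    have e4 := b₄.1 m hm
    rw [d₃ a ha.le, d₃ m hm.le] at e3
    rw [d₄ a ha.le, d₄ m hm.le] at e4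
    omega
  have glo : ∀ m < n, count σ p J₁ m - count σ p J₂ m < s → g m = g b := by
    intro m hm hsm
    have e3 := b₃.2 m hm
    have e4 := b₄.2 m hm
    rw [d₃ b hb.le, d₃ m hm.le] at e3
    rw [d₄ b hb.le, d₄ m hm.le] at e4
    omega
  have ga : g a = 0 := by
    rw [← ghi 0 (by omega) (by simpa using hs), g0]
  have gw₂ : g w₂ = 0 := by rw [ghi w₂ (by omega) l2, ga]
  have gw₁ := glo w₁ (by omega) l1
  have gw₃ := glo w₃ h3n l3
  have gb : g b ≠ 0 := by
    intro h0
    have gall : ∀ m ≤ n, g m = 0 := by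
      intro m hm
      rcases hm.lt_or_eq with hm | rfl
      · rcases le_or_gt s (count σ p J₁ m - count σ p J₂ m) with h | h
        · rw [ghi m hm h, ga]
        · rw [glo m hm h, h0]
      · exact gn
    have e1 := gall i hi.le
    have e2 := gall (i + 1) hi
    simp only [g] at e1 e2
    split_ifs at e1 e2 <;> omega
  -- The support of `g` is a single interval, yet `g` is nonzero at `w₁` and `w₃` and zero at `w₂`
  -- between them.
  rw [← gw₁] at gb gw₃
  simp only [g] at gw₂ gw₃ gb
  split_ifs at gw₂ gw₃ gb <;> omega

end DecoratedOSP

theorem mainTheorem4 (n k : ℕ) (hk : 1 ≤ k) (hkn : k < n) (l m : ℕ)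
    (S : DecoratedOSP n k l) (T : DecoratedOSP n k m)
    (hS : S.IsHypersimplicial) (hT : T.IsHypersimplicial)
    (σ : Equiv.Perm (Fin n)) (J₁ J₂ : Finset (Fin n))
    (hJ₁ : J₁.card = k) (hJ₂ : J₂.card = k)
    (h₁ : S.blade ∩ openHypersimplex k n = bladeAt σ J₁ ∩ openHypersimplex k n)
    (h₂ : T.blade ∩ openHypersimplex k n = bladeAt σ J₂ ∩ openHypersimplex k n) :
    IsMatroidSubdivision k n (commonRefinement S.cells T.cells) ↔
      WeaklySeparated σ J₁ J₂ := by
  rw [DecoratedOSP.bladeAt_eq σ J₁ hJ₁] at h₁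
  rw [DecoratedOSP.bladeAt_eq σ J₂ hJ₂] at h₂
  rw [commonRefinement_congr (by omega) S _ T _ h₁ h₂]
  constructor
  · exact fun h => DecoratedOSP.weaklySeparated_of_isMatroidPolytope σ hk hkn hJ₁ hJ₂ h.2
  · refine fun h => ⟨DecoratedOSP.isPolytopalSubdivision σ hk hkn hJ₁ hJ₂, ?_⟩
    rintro R ⟨⟨_, ⟨p, rfl⟩, _, ⟨q, rfl⟩, rfl⟩, hR⟩
    exact DecoratedOSP.isMatroidPolytope_of_weaklySeparated hJ₁ hJ₂ h p q
      (IsFullDim.nonempty (by omega) hR)
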